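/- Let $k$ be a commutative ring and let $\mathcal C$ be a pivotal fusion category over $k$, with chosen duals $X^*$ and left and right (co)evaluations. That is, $\mathcal C$ is a $k$-additive monoidal category (finite direct sums exist, composition and $\otimes$ are $k$-bilinear) in which: every object $X$ has an object $X^*$ that is both a left and a right dual of $X$, and the resulting left and right dual functors coincide as monoidal functors; every object is a finite direct sum of scalar objects (objects $i$ for which $k\to\mathrm{End}(i)$, $a\mapsto a\,\mathrm{id}_i$, is bijective); $\mathrm{Hom}(i,j)=0$ for non-isomorphic scalar objects $i,j$; there are finitely many isomorphism classes of scalar objects; and the unit object $\mathbb 1$ is scalar, so that $\mathrm{End}(\mathbb 1)=k$. Let $I$ be a representative set of scalar objects, that is, a set of scalar objects with $\mathbb 1\in I$ such that every scalar object is isomorphic to exactly one element of $I$. Put $\dim(\mathcal C)=\sum_{i\in I}\dim_l(i)\dim_r(i)\in k$, where $\dim_l$ and $\dim_r$ denote the left and right dimensions. A half braiding of $\mathcal C$ is a pair $(A,\sigma)$ of an object $A$ and a natural isomorphism $\sigma_Y\colon A\otimes Y\to Y\otimes A$ with $\sigma_{Y\otimes Y'}=(\mathrm{id}_Y\otimes\sigma_{Y'})(\sigma_Y\otimes\mathrm{id}_{Y'})$;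 half braidings are the objects of the center $\mathcal Z(\mathcal C)$, whose morphisms $(A,\sigma)\to(A',\sigma')$ are the morphisms $f\colon A\to A'$ with $(\mathrm{id}_Y\otimes f)\sigma_Y=\sigma'_Y(f\otimes\mathrm{id}_Y)$ for all $Y$. (The canonical associativity and unit isomorphisms are suppressed.) For an object $X$ of $\mathcal C$, the free half braiding is $F(X)=(Z(X),\varsigma_X)$ with $Z(X)=\bigoplus_{i\in I}i^*\otimes X\otimes i$, where the component of $\varsigma_{X,Y}\colon Z(X)\otimes Y\to Y\otimes Z(X)$ from $i^*\otimes X\otimes i\otimes Y$ to $Y\otimes j^*\otimes X\otimes j$ is $\sum_\alpha \widehat{q_\alpha}\otimes\mathrm{id}_X\otimes p_\alpha$. Here $(p_\alpha\colon i\otimes Y\to j,\ q_\alpha\colon j\to i\otimes Y)_\alpha$ are the projections and inclusions of the copies of $j$ in a decomposition of $i\otimes Y$ as a direct sum of elements of $I$, and $\widehat{q_\alpha}=(\mathrm{ev}_i\otimes\mathrm{id}_{Y\otimes j^*})(\mathrm{id}_{i^*}\otimes q_\alpha\otimes\mathrm{id}_{j^*})(\mathrm{id}_{i^*}\otimes\mathrm{coev}_j)\colon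 i^*\to Y\otimes j^*$, with $\mathrm{ev}_i\colon i^*\otimes i\to\mathbb 1$ and $\mathrm{coev}_j\colon\mathbb 1\to j\otimes j^*$ the left evaluation and coevaluation; $\varsigma_X$ does not depend on the choice of the decompositions. Then $\dim(\mathcal C)$ is invertible in $k$ if and only if every half braiding of $\mathcal C$ is a retract, in $\mathcal Z(\mathcal C)$, of $F(X)$ for some object $X$ of $\mathcal C$. -/

import Mathlib

open CategoryTheory MonoidalCategory Limits

universe w v u

namespace FusionCenter

section Pivotal

variable {C : Type u} [Category.{v} C] [MonoidalCategory C]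

/-- The dual `f^* : Y' ⟶ X'` of a morphism `f : X ⟶ Y`, computed from left duals `X'` of `X` and
`Y'` of `Y` (evaluations `X' ⊗ X ⟶ 𝟙`, coevaluations `𝟙 ⟶ X ⊗ X'`):
`f^* = (ev_Y ⊗ id) (id ⊗ f ⊗ id) (id ⊗ coev_X)`. -/
def leftMate {X X' Y Y' : C} (pX : ExactPairing X X') (pY : ExactPairing Y Y') (f : X ⟶ Y) :
    Y' ⟶ X' :=
  @rightAdjointMate C _ _ X Y (@HasRightDual.mk C _ _ X X' pX) (@HasRightDual.mk C _ _ Y Y' pY) f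

/-- The dual `f^* : Y' ⟶ X'` of a morphism `f : X ⟶ Y`, computed from right duals `X'` of `X` and
`Y'` of `Y` (evaluations `X ⊗ X' ⟶ 𝟙`, coevaluations `𝟙 ⟶ X' ⊗ X`):
`f^* = (id ⊗ ev_Y) (id ⊗ f ⊗ id) (coev_X ⊗ id)`. -/
def rightMate {X X' Y Y' : C} (pX : ExactPairing X' X) (pY : ExactPairing Y' Y) (f : X ⟶ Y) :
    Y' ⟶ X' :=
  @leftAdjointMate C _ _ X Y (@HasLeftDual.mk C _ _ X X' pX) (@HasLeftDual.mk C _ _ Y Y' pY) f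

variable (C) in
/-- A pivotal category: every object `X` has a dual object `X^*` which is both a left dual and a
right dual of `X`, in such a way that the resulting left and right dual functors coincide as
monoidal functors (on morphisms, and in their monoidal and unit constraints
`Y^* ⊗ X^* ⟶ (X ⊗ Y)^*` and `𝟙 ⟶ 𝟙^*`). -/
class PivotalCategory where
  /-- the dual object `X^*` -/
  dual : C → C
  /-- `X^* ⊗ X ⟶ 𝟙` and `𝟙 ⟶ X ⊗ X^*` -/
  leftPairing (X : C) : ExactPairing X (dual X)
  /-- `X ⊗ X^* ⟶ 𝟙` and `𝟙 ⟶ X^* ⊗ X` -/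
  rightPairing (X : C) : ExactPairing (dual X) X
  dual_map {X Y : C} (f : X ⟶ Y) :
    leftMate (leftPairing X) (leftPairing Y) f = rightMate (rightPairing X) (rightPairing Y) f
  dual_tensor (X Y : C) :
    leftMate (leftPairing (X ⊗ Y))
        (@ExactPairing.tensor C _ _ X Y (dual X) (dual Y) (leftPairing X) (leftPairing Y))
        (𝟙 (X ⊗ Y)) =
      rightMate (rightPairing (X ⊗ Y))
        (@ExactPairing.tensor C _ _ (dual Y) (dual X) Y X (rightPairing Y) (rightPairing X))
        (𝟙 (X ⊗ Y))
  dual_unit :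
    leftMate (leftPairing (𝟙_ C)) exactPairingUnit (𝟙 (𝟙_ C)) =
      rightMate (rightPairing (𝟙_ C)) exactPairingUnit (𝟙 (𝟙_ C))

variable [PivotalCategory C]

/-- The dual object `X^*`. -/
def dual (X : C) : C := PivotalCategory.dual X

/-- The left evaluation `X^* ⊗ X ⟶ 𝟙`. -/
def lev (X : C) : dual X ⊗ X ⟶ 𝟙_ C :=
  (PivotalCategory.leftPairing X).evaluation'

/-- The left coevaluation `𝟙 ⟶ X ⊗ X^*`. -/
def lcoev (X : C) : 𝟙_ C ⟶ X ⊗ dual X :=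
  (PivotalCategory.leftPairing X).coevaluation'

/-- The right evaluation `X ⊗ X^* ⟶ 𝟙`. -/
def rev (X : C) : X ⊗ dual X ⟶ 𝟙_ C :=
  (PivotalCategory.rightPairing X).evaluation'

/-- The right coevaluation `𝟙 ⟶ X^* ⊗ X`. -/
def rcoev (X : C) : 𝟙_ C ⟶ dual X ⊗ X :=
  (PivotalCategory.rightPairing X).coevaluation'

/-- The left trace of an endomorphism. -/
def leftTrace {X : C} (f : X ⟶ X) : 𝟙_ C ⟶ 𝟙_ C := rcoev X ≫ dual X ◁ f ≫ lev X

/-- The right trace of an endomorphism. -/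
def rightTrace {X : C} (f : X ⟶ X) : 𝟙_ C ⟶ 𝟙_ C := lcoev X ≫ f ▷ dual X ≫ rev X

lemma lcoev_lev (X : C) : lcoev X ▷ X ⊗≫ X ◁ lev X = ⊗𝟙.hom :=
  @ExactPairing.evaluation_coevaluation'' C _ _ X (dual X) (PivotalCategory.leftPairing X)

lemma lev_lcoev (X : C) : dual X ◁ lcoev X ⊗≫ lev X ▷ dual X = ⊗𝟙.hom :=
  @ExactPairing.coevaluation_evaluation'' C _ _ X (dual X) (PivotalCategory.leftPairing X)

lemma rcoev_rev (X : C) : rcoev X ▷ dual X ⊗≫ dual X ◁ rev X = ⊗𝟙.hom :=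
  @ExactPairing.evaluation_coevaluation'' C _ _ (dual X) X (PivotalCategory.rightPairing X)

lemma rev_rcoev (X : C) : X ◁ rcoev X ⊗≫ rev X ▷ X = ⊗𝟙.hom :=
  @ExactPairing.coevaluation_evaluation'' C _ _ (dual X) X (PivotalCategory.rightPairing X)

end Pivotal

section Fusion

variable (k : Type w) [CommRing k]
variable {C : Type u} [Category.{v} C] [Preadditive C] [Linear k C]

/-- An object `X` is scalar if `k → End X`, `a ↦ a • 𝟙 X` is bijective. -/
def IsScalar (X : C) : Prop := Function.Bijective (fun a : k => a • 𝟙 X)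

variable (C) in
/-- The conditions that make a `k`-additive monoidal category a fusion category over the commutative
ring `k`. (That `C` has finite direct sums and that composition and tensor product of morphisms are
`k`-bilinear is expressed by Mathlib's classes.) -/
class IsFusionCategory [MonoidalCategory C] [HasFiniteBiproducts C] [MonoidalPreadditive C]
    [MonoidalLinear k C] : Prop where
  exists_left_dual (X : C) : ∃ X' : C, Nonempty (ExactPairing X X')
  exists_right_dual (X : C) : ∃ X' : C, Nonempty (ExactPairing X' X)
  exists_iso_biproduct (X : C) :
    ∃ (n : ℕ) (S : Fin n → C), (∀ a, IsScalar k (S a)) ∧ Nonempty (X ≅ ⨁ S)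
  hom_eq_zero {i j : C} (hi : IsScalar k i) (hj : IsScalar k j) (hij : IsEmpty (i ≅ j))
    (f : i ⟶ j) : f = 0
  finite_scalar :
    {c : Quotient (isIsomorphicSetoid C) | ∃ i : C, IsScalar k i ∧ c = Quotient.mk _ i}.Finite
  scalar_unit : IsScalar k (𝟙_ C)

/-- A representative set of scalar objects: it consists of scalar objects, contains the unit object,
and every scalar object is isomorphic to exactly one of its elements. (In a fusion category such a
set is automatically finite.) -/
structure IsRepresentativeSet [MonoidalCategory C] (I : Finset C) : Prop where
  scalar : ∀ i ∈ I, IsScalar k i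
  unit_mem : 𝟙_ C ∈ I
  existsUnique_iso (X : C) : IsScalar k X → ∃! i, i ∈ I ∧ Nonempty (X ≅ i)

end Fusion

section Dimension

variable (k : Type w) [CommRing k]
variable {C : Type u} [Category.{v} C] [Preadditive C] [Linear k C] [MonoidalCategory C]
  [HasFiniteBiproducts C] [MonoidalPreadditive C] [MonoidalLinear k C] [IsFusionCategory k C]

/-- The canonical identification of `End 𝟙` with `k`. -/
noncomputable def unitCoeff : (𝟙_ C ⟶ 𝟙_ C) ≃ k :=
  (Equiv.ofBijective _ (IsFusionCategory.scalar_unit (k := k) (C := C))).symm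

variable [PivotalCategory C]

/-- The left dimension of an object, an element of `k`. -/
noncomputable def leftDim (X : C) : k := unitCoeff k (leftTrace (𝟙 X))

/-- The right dimension of an object, an element of `k`. -/
noncomputable def rightDim (X : C) : k := unitCoeff k (rightTrace (𝟙 X))

/-- The dimension of a pivotal fusion category with representative set `I` of scalar objects. -/
noncomputable def categoryDim (I : Finset C) : k := ∑ i ∈ I, leftDim k i * rightDim k i

end Dimension

section Partition

variable {C : Type u} [Category.{v} C] [Preadditive C]

/-- An explicit decomposition of `Y` as a direct sum of objects in `I`. The members of the
family with label `i` form an `i`-decomposition of `Y`. -/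
structure ScalarPartition (I : Finset C) (Y : C) where
  /-- the number of summands -/
  n : ℕ
  /-- the summands -/
  label : Fin n → I
  /-- the projections -/
  p (a : Fin n) : Y ⟶ (label a : C)
  /-- the inclusions -/
  q (a : Fin n) : (label a : C) ⟶ Y
  q_p_self (a : Fin n) : q a ≫ p a = 𝟙 _
  q_p_ne {a b : Fin n} (h : a ≠ b) : q a ≫ p b = 0
  total : ∑ a, p a ≫ q a = 𝟙 Y

variable (k : Type w) [CommRing k] [Linear k C] [MonoidalCategory C]
  [HasFiniteBiproducts C] [MonoidalPreadditive C] [MonoidalLinear k C]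

lemma nonempty_scalarPartition [IsFusionCategory k C] {I : Finset C}
    (hI : IsRepresentativeSet k I) (Y : C) : Nonempty (ScalarPartition I Y) := by
  obtain ⟨n, S, hS, ⟨e⟩⟩ := IsFusionCategory.exists_iso_biproduct (k := k) Y
  choose l hl _ using fun a => hI.existsUnique_iso (S a) (hS a)
  have e' : ∀ a, S a ≅ l a := fun a => (hl a).2.some
  refine ⟨{ n := n, label := fun a => ⟨l a, (hl a).1⟩
            p := fun a => e.hom ≫ biproduct.π S a ≫ (e' a).hom
            q := fun a => (e' a).inv ≫ biproduct.ι S a ≫ e.inv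
            q_p_self := fun a => by simp
            q_p_ne := fun {a b} h => by simp [biproduct.ι_π_ne_assoc S h]
            total := ?_ }⟩
  have : ∀ a, (e.hom ≫ biproduct.π S a ≫ (e' a).hom) ≫ (e' a).inv ≫ biproduct.ι S a ≫ e.inv =
      e.hom ≫ (biproduct.π S a ≫ biproduct.ι S a) ≫ e.inv := fun a => by simp
  simp only [this, ← Preadditive.comp_sum, ← Preadditive.sum_comp, biproduct.total]
  simp

/-- A chosen decomposition of `Y` into objects of `I`; nothing below depends on the choice. -/
noncomputable def partition [IsFusionCategory k C] {I : Finset C}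
    (hI : IsRepresentativeSet k I) (Y : C) : ScalarPartition I Y :=
  (nonempty_scalarPartition k hI Y).some

end Partition

section Free

variable {C : Type u} [Category.{v} C] [MonoidalCategory C] [PivotalCategory C]

/-- The morphism `i^* ⟶ Y ⊗ j^*` obtained from `q : j ⟶ i ⊗ Y` by duality, that is,
`(ev_i ⊗ id) (id ⊗ q ⊗ id) (id ⊗ coev_j)`. -/
def bend {i j Y : C} (q : j ⟶ i ⊗ Y) : dual i ⟶ Y ⊗ dual j :=
  (ρ_ (dual i)).inv ≫ dual i ◁ lcoev j ≫ dual i ◁ q ▷ dual j ≫ dual i ◁ (α_ i Y (dual j)).hom ≫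
    (α_ (dual i) i (Y ⊗ dual j)).inv ≫ lev i ▷ (Y ⊗ dual j) ≫ (λ_ (Y ⊗ dual j)).hom

/-- For `q : j ⟶ i ⊗ Y'` and `p : i ⊗ Y ⟶ j`, the morphism
`bend q ⊗ id_X ⊗ p : i^* ⊗ X ⊗ i ⊗ Y ⟶ Y' ⊗ j^* ⊗ X ⊗ j`. -/
def bendMap (X : C) {i j Y Y' : C} (q : j ⟶ i ⊗ Y') (p : i ⊗ Y ⟶ j) :
    (dual i ⊗ (X ⊗ i)) ⊗ Y ⟶ Y' ⊗ (dual j ⊗ (X ⊗ j)) :=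
  (α_ (dual i) (X ⊗ i) Y).hom ≫ dual i ◁ (α_ X i Y).hom ≫ dual i ◁ X ◁ p ≫
    bend q ▷ (X ⊗ j) ≫ (α_ Y' (dual j) (X ⊗ j)).hom

variable [Preadditive C] [HasFiniteBiproducts C]

/-- The object `Z(X) = ⨁_{i ∈ I} i^* ⊗ X ⊗ i`. -/
noncomputable def freeObj (I : Finset C) (X : C) : C :=
  ⨁ fun i : I => dual (i : C) ⊗ (X ⊗ (i : C))

/-- The inclusion of the summand of index `i` in `Z(X)`. -/
noncomputable def freeι {I : Finset C} (X : C) (i : I) :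
    dual (i : C) ⊗ (X ⊗ (i : C)) ⟶ freeObj I X :=
  biproduct.ι (fun i : I => dual (i : C) ⊗ (X ⊗ (i : C))) i

/-- The projection of `Z(X)` onto the summand of index `i`. -/
noncomputable def freeπ {I : Finset C} (X : C) (i : I) :
    freeObj I X ⟶ dual (i : C) ⊗ (X ⊗ (i : C)) :=
  biproduct.π (fun i : I => dual (i : C) ⊗ (X ⊗ (i : C))) i

lemma freeι_freeπ_self {I : Finset C} (X : C) (i : I) : freeι X i ≫ freeπ X i = 𝟙 _ :=
  biproduct.ι_π_self _ i

lemma freeι_freeπ_ne {I : Finset C} (X : C) {i j : I} (h : i ≠ j) :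
    freeι X i ≫ freeπ X j = 0 :=
  biproduct.ι_π_ne _ h

lemma free_total {I : Finset C} (X : C) : ∑ i : I, freeπ X i ≫ freeι X i = 𝟙 (freeObj I X) := by
  classical
  refine biproduct.hom_ext' _ _ fun i => ?_
  change freeι X i ≫ _ = freeι X i ≫ _
  rw [Preadditive.comp_sum, Finset.sum_eq_single i]
  · rw [← Category.assoc, freeι_freeπ_self, Category.id_comp, Category.comp_id]
  · intro j _ hj
    rw [← Category.assoc, freeι_freeπ_ne X hj.symm, zero_comp]
  · simp

variable (k : Type w) [CommRing k] [Linear k C] [MonoidalPreadditive C] [MonoidalLinear k C]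
  [IsFusionCategory k C]

/-- The half braiding `ς_{X,Y} : Z(X) ⊗ Y ⟶ Y ⊗ Z(X)`. Its component from the summand `i` to the
summand `j` is `∑_a bend q_a ⊗ id_X ⊗ p_a`, where `(p_a : i ⊗ Y ⟶ j, q_a : j ⟶ i ⊗ Y)_a` is
a `j`-decomposition of `i ⊗ Y`. -/
noncomputable def freeBraid {I : Finset C} (hI : IsRepresentativeSet k I) (X Y : C) :
    freeObj I X ⊗ Y ⟶ Y ⊗ freeObj I X :=
  ∑ i : I, ∑ a : Fin (partition k hI ((i : C) ⊗ Y)).n,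
    freeπ X i ▷ Y ≫
      bendMap X ((partition k hI ((i : C) ⊗ Y)).q a) ((partition k hI ((i : C) ⊗ Y)).p a) ≫
        Y ◁ freeι X ((partition k hI ((i : C) ⊗ Y)).label a)

end Free


section FreeLemmas

variable {C : Type u} [Category.{v} C] [MonoidalCategory C] [PivotalCategory C]

lemma bend_comp_whiskerLeft {i j Y Y' : C} (q : j ⟶ i ⊗ Y) (f : Y ⟶ Y') :
    bend (q ≫ i ◁ f) = bend q ≫ f ▷ dual j := by
  dsimp only [bend]
  calc
    _ = 𝟙 _ ⊗≫ dual i ◁ lcoev j ⊗≫ dual i ◁ q ▷ dual j ⊗≫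
        ((dual i ⊗ i) ◁ (f ▷ dual j) ≫ lev i ▷ (Y' ⊗ dual j)) ⊗≫ 𝟙 _ := by monoidal
    _ = 𝟙 _ ⊗≫ dual i ◁ lcoev j ⊗≫ dual i ◁ q ▷ dual j ⊗≫
        (lev i ▷ (Y ⊗ dual j) ≫ 𝟙_ C ◁ (f ▷ dual j)) ⊗≫ 𝟙 _ := by rw [whisker_exchange]
    _ = _ := by monoidal

lemma lcoev_bend {j l Y : C} (h : l ⟶ j ⊗ Y) :
    lcoev j ≫ j ◁ bend h = lcoev l ≫ h ▷ dual l ≫ (α_ j Y (dual l)).hom := by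
  dsimp only [bend]
  calc
    _ = 𝟙 _ ⊗≫ (lcoev j ▷ 𝟙_ C ≫ (j ⊗ dual j) ◁ (lcoev l ≫ h ▷ dual l)) ⊗≫
          j ◁ lev j ▷ (Y ⊗ dual l) ⊗≫ 𝟙 _ := by monoidal
    _ = 𝟙 _ ⊗≫ (lcoev l ≫ h ▷ dual l) ⊗≫ (lcoev j ▷ j ⊗≫ j ◁ lev j) ▷ (Y ⊗ dual l) ⊗≫ 𝟙 _ := by
      rw [← whisker_exchange]; monoidal
    _ = _ := by rw [lcoev_lev]; monoidal

lemma bend_tensor {i j l Y Y' : C} (h : j ⟶ i ⊗ Y) (h' : l ⟶ j ⊗ Y') :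
    bend (h' ≫ h ▷ Y' ≫ (α_ i Y Y').hom) =
      bend h ≫ Y ◁ bend h' ≫ (α_ Y Y' (dual l)).inv := by
  symm
  rw [bend]
  calc
    _ = 𝟙 _ ⊗≫ dual i ◁ lcoev j ⊗≫ dual i ◁ h ▷ dual j ⊗≫
          (lev i ▷ (Y ⊗ dual j) ≫ 𝟙_ C ◁ (Y ◁ bend h')) ⊗≫ 𝟙 _ := by monoidal
    _ = 𝟙 _ ⊗≫ dual i ◁ lcoev j ⊗≫ dual i ◁ (h ▷ dual j ≫ (i ⊗ Y) ◁ bend h') ⊗≫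
          lev i ▷ (Y ⊗ Y' ⊗ dual l) ⊗≫ 𝟙 _ := by
      rw [← whisker_exchange]; monoidal
    _ = 𝟙 _ ⊗≫ dual i ◁ (lcoev j ≫ j ◁ bend h') ⊗≫ dual i ◁ h ▷ (Y' ⊗ dual l) ⊗≫
          lev i ▷ (Y ⊗ Y' ⊗ dual l) ⊗≫ 𝟙 _ := by
      rw [← whisker_exchange]; monoidal
    _ = _ := by rw [lcoev_bend, bend]; monoidal

lemma bend_unit (i : C) : bend (ρ_ i).inv = (λ_ (dual i)).inv := by
  dsimp only [bend]
  calc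
    _ = 𝟙 _ ⊗≫ (dual i ◁ lcoev i ⊗≫ lev i ▷ dual i) ⊗≫ 𝟙 _ := by monoidal
    _ = _ := by rw [lev_lcoev]; monoidal

lemma bendMap_naturality_left (X : C) {i j Y Y' Y'' : C} (q : j ⟶ i ⊗ Y') (p : i ⊗ Y ⟶ j)
    (f : Y' ⟶ Y'') : bendMap X (q ≫ i ◁ f) p = bendMap X q p ≫ f ▷ _ := by
  simp [bendMap, bend_comp_whiskerLeft]

lemma bendMap_naturality_right (X : C) {i j Y Y' Y'' : C} (q : j ⟶ i ⊗ Y') (p : i ⊗ Y ⟶ j)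
    (f : Y'' ⟶ Y) : bendMap X q (i ◁ f ≫ p) = _ ◁ f ≫ bendMap X q p := by
  simp [bendMap]

lemma bendMap_tensor (X : C) {i j l Y Y' : C} (q : j ⟶ i ⊗ Y) (p : i ⊗ Y ⟶ j)
    (q' : l ⟶ j ⊗ Y') (p' : j ⊗ Y' ⟶ l) :
    bendMap X (q' ≫ q ▷ Y' ≫ (α_ i Y Y').hom) ((α_ i Y Y').inv ≫ p ▷ Y' ≫ p') =
      (α_ _ _ _).inv ≫ bendMap X q p ▷ Y' ≫ (α_ _ _ _).hom ≫ Y ◁ bendMap X q' p' ≫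
        (α_ _ _ _).inv := by
  symm
  simp only [bendMap, bend_tensor]
  calc
    _ = 𝟙 _ ⊗≫ dual i ◁ X ◁ p ▷ Y' ⊗≫
        (bend q ▷ (X ⊗ j ⊗ Y') ≫ (Y ⊗ dual j) ◁ (X ◁ p')) ⊗≫
        Y ◁ bend q' ▷ (X ⊗ l) ⊗≫ 𝟙 _ := by monoidal
    _ = _ := by rw [← whisker_exchange]; monoidal

/-- In a pivotal category, a family `A ⊗ Y ⟶ Y ⊗ A` that is natural and multiplicative in `Y`
and canonical for the unit object is invertible; this is its inverse. -/
def braidInv {A : C} (s : ∀ Y, A ⊗ Y ⟶ Y ⊗ A) (Y : C) : Y ⊗ A ⟶ A ⊗ Y :=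
  𝟙 _ ⊗≫ (Y ⊗ A) ◁ rcoev Y ⊗≫ Y ◁ s (dual Y) ▷ Y ⊗≫ rev Y ▷ (A ⊗ Y) ⊗≫ 𝟙 _

lemma braid_comp_inv {A : C} (s : ∀ Y, A ⊗ Y ⟶ Y ⊗ A)
    (hnat : ∀ {Y Y' : C} (f : Y ⟶ Y'), A ◁ f ≫ s Y' = s Y ≫ f ▷ A)
    (hten : ∀ Y Y', s (Y ⊗ Y') = (α_ _ _ _).inv ≫ s Y ▷ Y' ≫ (α_ _ _ _).hom ≫ Y ◁ s Y' ≫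
      (α_ _ _ _).inv)
    (hunit : s (𝟙_ C) = (ρ_ A).hom ≫ (λ_ A).inv) (Y : C) : s Y ≫ braidInv s Y = 𝟙 _ := by
  have h1 := hnat (rev Y)
  rw [hten, hunit] at h1
  dsimp only [braidInv]
  calc
    _ = 𝟙 _ ⊗≫ (s Y ▷ 𝟙_ C ≫ (Y ⊗ A) ◁ rcoev Y) ⊗≫ Y ◁ s (dual Y) ▷ Y ⊗≫
        rev Y ▷ (A ⊗ Y) ⊗≫ 𝟙 _ := by monoidal
    _ = 𝟙 _ ⊗≫ (A ⊗ Y) ◁ rcoev Y ⊗≫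
        (((α_ _ _ _).inv ≫ s Y ▷ dual Y ≫ (α_ _ _ _).hom ≫ Y ◁ s (dual Y) ≫ (α_ _ _ _).inv) ≫
          rev Y ▷ A) ▷ Y ⊗≫ 𝟙 _ := by
      rw [← whisker_exchange]; monoidal
    _ = 𝟙 _ ⊗≫ A ◁ (Y ◁ rcoev Y ⊗≫ rev Y ▷ Y) ⊗≫ 𝟙 _ := by
      rw [← h1]; monoidal
    _ = _ := by rw [rev_rcoev]; monoidal

lemma inv_comp_braid {A : C} (s : ∀ Y, A ⊗ Y ⟶ Y ⊗ A)
    (hnat : ∀ {Y Y' : C} (f : Y ⟶ Y'), A ◁ f ≫ s Y' = s Y ≫ f ▷ A)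
    (hten : ∀ Y Y', s (Y ⊗ Y') = (α_ _ _ _).inv ≫ s Y ▷ Y' ≫ (α_ _ _ _).hom ≫ Y ◁ s Y' ≫
      (α_ _ _ _).inv)
    (hunit : s (𝟙_ C) = (ρ_ A).hom ≫ (λ_ A).inv) (Y : C) : braidInv s Y ≫ s Y = 𝟙 _ := by
  have h1 := hnat (rcoev Y)
  rw [hten, hunit] at h1
  dsimp only [braidInv]
  calc
    _ = 𝟙 _ ⊗≫ (Y ⊗ A) ◁ rcoev Y ⊗≫ Y ◁ s (dual Y) ▷ Y ⊗≫
        (rev Y ▷ (A ⊗ Y) ≫ 𝟙_ C ◁ s Y) ⊗≫ 𝟙 _ := by monoidal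
    _ = 𝟙 _ ⊗≫ Y ◁ (A ◁ rcoev Y ≫ ((α_ _ _ _).inv ≫ s (dual Y) ▷ Y ≫ (α_ _ _ _).hom ≫
          dual Y ◁ s Y ≫ (α_ _ _ _).inv)) ⊗≫ rev Y ▷ (Y ⊗ A) ⊗≫ 𝟙 _ := by
      rw [← whisker_exchange]; monoidal
    _ = 𝟙 _ ⊗≫ (Y ◁ rcoev Y ⊗≫ rev Y ▷ Y) ▷ A ⊗≫ 𝟙 _ := by
      rw [h1]; monoidal
    _ = _ := by rw [rev_rcoev]; monoidal

end FreeLemmas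

section FreeCenter

variable {C : Type u} [Category.{v} C] [MonoidalCategory C] [PivotalCategory C]
  [Preadditive C] [MonoidalPreadditive C]

lemma bend_sum {i j Y : C} {A : Type*} (s : Finset A) (q : A → (j ⟶ i ⊗ Y)) :
    bend (∑ a ∈ s, q a) = ∑ a ∈ s, bend (q a) := by
  simp only [bend, sum_whiskerRight, whiskerLeft_sum, Preadditive.comp_sum,
    Preadditive.sum_comp]

lemma bendMap_sum_left (X : C) {i j Y Y' : C} {A : Type*} (s : Finset A)
    (q : A → (j ⟶ i ⊗ Y')) (p : i ⊗ Y ⟶ j) :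
    bendMap X (∑ a ∈ s, q a) p = ∑ a ∈ s, bendMap X (q a) p := by
  simp only [bendMap, bend_sum, sum_whiskerRight, Preadditive.comp_sum, Preadditive.sum_comp]

lemma bendMap_sum_right (X : C) {i j Y Y' : C} {A : Type*} (s : Finset A)
    (q : j ⟶ i ⊗ Y') (p : A → (i ⊗ Y ⟶ j)) :
    bendMap X q (∑ a ∈ s, p a) = ∑ a ∈ s, bendMap X q (p a) := by
  simp only [bendMap, whiskerLeft_sum, Preadditive.comp_sum, Preadditive.sum_comp]

lemma bendMap_zero_left (X : C) {i j Y Y' : C} (p : i ⊗ Y ⟶ j) :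
    bendMap X (0 : j ⟶ i ⊗ Y') p = 0 := by
  simp [bendMap, bend]

lemma bendMap_zero_right (X : C) {i j Y Y' : C} (q : j ⟶ i ⊗ Y') :
    bendMap X q (0 : i ⊗ Y ⟶ j) = 0 := by
  simp [bendMap]

lemma bendMap_smul_left (k : Type w) [CommRing k] [Linear k C] [MonoidalLinear k C]
    (X : C) {i j Y Y' : C} (c : k) (q : j ⟶ i ⊗ Y') (p : i ⊗ Y ⟶ j) :
    bendMap X (c • q) p = c • bendMap X q p := by
  simp [bendMap, bend]

lemma bendMap_smul_right (k : Type w) [CommRing k] [Linear k C] [MonoidalLinear k C]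
    (X : C) {i j Y Y' : C} (c : k) (q : j ⟶ i ⊗ Y') (p : i ⊗ Y ⟶ j) :
    bendMap X q (c • p) = c • bendMap X q p := by
  simp [bendMap]

variable [HasFiniteBiproducts C]

lemma free_hom_ext {I : Finset C} {X Y Z : C} {f g : freeObj I X ⊗ Y ⟶ Z}
    (h : ∀ i : I, freeι X i ▷ Y ≫ f = freeι X i ▷ Y ≫ g) : f = g := by
  have h1 : 𝟙 (freeObj I X ⊗ Y) = ∑ i : I, freeπ X i ▷ Y ≫ freeι X i ▷ Y := by
    simp only [← comp_whiskerRight, ← sum_whiskerRight, free_total, id_whiskerRight]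
  rw [← Category.id_comp f, ← Category.id_comp g, h1, Preadditive.sum_comp, Preadditive.sum_comp]
  exact Finset.sum_congr rfl fun i _ => by rw [Category.assoc, Category.assoc, h i]

variable (k : Type w) [CommRing k] [Linear k C] [MonoidalLinear k C]
  [IsFusionCategory k C] {I : Finset C} (hI : IsRepresentativeSet k I)

lemma freeι_freeBraid (X Y : C) (i : I) :
    freeι X i ▷ Y ≫ freeBraid k hI X Y = ∑ a : Fin (partition k hI ((i : C) ⊗ Y)).n,
      bendMap X ((partition k hI ((i : C) ⊗ Y)).q a) ((partition k hI ((i : C) ⊗ Y)).p a) ≫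
        Y ◁ freeι X ((partition k hI ((i : C) ⊗ Y)).label a) := by
  classical
  rw [freeBraid, Preadditive.comp_sum, Finset.sum_eq_single i]
  · rw [Preadditive.comp_sum]
    refine Finset.sum_congr rfl fun a _ => ?_
    rw [← comp_whiskerRight_assoc, freeι_freeπ_self, id_whiskerRight,
      Category.id_comp]
  · intro j _ hj
    rw [Preadditive.comp_sum]
    refine Finset.sum_eq_zero fun a _ => ?_
    rw [← comp_whiskerRight_assoc, freeι_freeπ_ne X hj.symm,
      MonoidalPreadditive.zero_whiskerRight, zero_comp]
  · simp

lemma bendMap_dinat (hI : IsRepresentativeSet k I) (X : C) {i Y Y' : C} {j j' : I}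
    (g : (j : C) ⟶ j') (q : (j' : C) ⟶ i ⊗ Y') (p : i ⊗ Y ⟶ j) :
    bendMap X (g ≫ q) p ≫ Y' ◁ freeι X j = bendMap X q (p ≫ g) ≫ Y' ◁ freeι X j' := by
  by_cases h : j = j'
  · subst h
    obtain ⟨c, rfl⟩ := (hI.scalar _ j.2).2 g
    simp [bendMap_smul_left, bendMap_smul_right]
  · have hg : g = 0 := by
      refine IsFusionCategory.hom_eq_zero (hI.scalar _ j.2) (hI.scalar _ j'.2) ⟨fun e => h ?_⟩ g
      exact Subtype.ext ((hI.existsUnique_iso (j : C) (hI.scalar _ j.2)).unique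
        ⟨j.2, ⟨Iso.refl _⟩⟩ ⟨j'.2, ⟨e⟩⟩)
    rw [hg, zero_comp, comp_zero, bendMap_zero_left, bendMap_zero_right, zero_comp, zero_comp]

lemma sum_bendMap_change (hI : IsRepresentativeSet k I) (X : C) {i Y Y' : C}
    (f : i ⊗ Y ⟶ i ⊗ Y') {A B : Type*} [Fintype A] [Fintype B] (l : A → I) (m : B → I)
    (p : ∀ a, i ⊗ Y ⟶ (l a : C)) (q : ∀ a, (l a : C) ⟶ i ⊗ Y) (hpq : ∑ a, p a ≫ q a = 𝟙 _)
    (p' : ∀ b, i ⊗ Y' ⟶ (m b : C)) (q' : ∀ b, (m b : C) ⟶ i ⊗ Y')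
    (hpq' : ∑ b, p' b ≫ q' b = 𝟙 _) :
    ∑ a, bendMap X (q a ≫ f) (p a) ≫ Y' ◁ freeι X (l a) =
      ∑ b, bendMap X (q' b) (f ≫ p' b) ≫ Y' ◁ freeι X (m b) := by
  have h1 : ∀ a, q a ≫ f = ∑ b, (q a ≫ f ≫ p' b) ≫ q' b := fun a => by
    simp only [Category.assoc, ← Preadditive.comp_sum, hpq', Category.comp_id]
  have h2 : ∀ b, f ≫ p' b = ∑ a, p a ≫ q a ≫ f ≫ p' b := fun b => by
    simp only [← Category.assoc, ← Preadditive.sum_comp, hpq, Category.id_comp]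
  calc
    _ = ∑ a, ∑ b, bendMap X ((q a ≫ f ≫ p' b) ≫ q' b) (p a) ≫ Y' ◁ freeι X (l a) := by
      refine Finset.sum_congr rfl fun a _ => ?_
      rw [h1, bendMap_sum_left, Preadditive.sum_comp]
    _ = ∑ a, ∑ b, bendMap X (q' b) (p a ≫ q a ≫ f ≫ p' b) ≫ Y' ◁ freeι X (m b) :=
      Finset.sum_congr rfl fun a _ => Finset.sum_congr rfl fun b _ =>
        bendMap_dinat k hI X _ _ _
    _ = _ := by
      rw [Finset.sum_comm]
      refine Finset.sum_congr rfl fun b _ => ?_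
      conv_rhs => rw [h2 b, bendMap_sum_right, Preadditive.sum_comp]

lemma freeBraid_naturality (X : C) {Y Y' : C} (f : Y ⟶ Y') :
    freeObj I X ◁ f ≫ freeBraid k hI X Y' = freeBraid k hI X Y ≫ f ▷ freeObj I X := by
  refine free_hom_ext fun i => ?_
  rw [← whisker_exchange_assoc, freeι_freeBraid, reassoc_of% (freeι_freeBraid k hI X Y i),
    Preadditive.comp_sum, Preadditive.sum_comp]
  have := sum_bendMap_change k hI X ((i : C) ◁ f) _ _ _ _
    (partition k hI ((i : C) ⊗ Y)).total _ _ (partition k hI ((i : C) ⊗ Y')).total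
  simp only [bendMap_naturality_left, bendMap_naturality_right, Category.assoc] at this
  simp only [Category.assoc, ← this, whisker_exchange]

lemma freeBraid_unit (X : C) :
    freeBraid k hI X (𝟙_ C) = (ρ_ (freeObj I X)).hom ≫ (λ_ (freeObj I X)).inv := by
  refine free_hom_ext fun i => ?_
  have := sum_bendMap_change k hI X (𝟙 ((i : C) ⊗ 𝟙_ C)) _ (fun _ : Unit => i) _ _
    (partition k hI ((i : C) ⊗ 𝟙_ C)).total (fun _ => (ρ_ (i : C)).hom) (fun _ => (ρ_ (i : C)).inv)
    (by simp)
  simp only [Category.id_comp, Category.comp_id] at this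
  rw [freeι_freeBraid, this]
  simp [bendMap, bend_unit]

lemma freeBraid_tensor (X Y Y' : C) :
    freeBraid k hI X (Y ⊗ Y') = (α_ _ _ _).inv ≫ freeBraid k hI X Y ▷ Y' ≫ (α_ _ _ _).hom ≫
      Y ◁ freeBraid k hI X Y' ≫ (α_ _ _ _).inv := by
  refine free_hom_ext fun i => ?_
  let P := partition k hI ((i : C) ⊗ Y)
  let Q : ∀ a, ScalarPartition I ((P.label a : C) ⊗ Y') := fun a => partition k hI _
  have htot : ∑ x : (Σ a : Fin P.n, Fin (Q a).n),
      ((α_ (i : C) Y Y').inv ≫ P.p x.1 ▷ Y' ≫ (Q x.1).p x.2) ≫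
        ((Q x.1).q x.2 ≫ P.q x.1 ▷ Y' ≫ (α_ (i : C) Y Y').hom) = 𝟙 _ := by
    rw [Fintype.sum_sigma]
    have : ∀ a, ∑ b, ((α_ (i : C) Y Y').inv ≫ P.p a ▷ Y' ≫ (Q a).p b) ≫
        ((Q a).q b ≫ P.q a ▷ Y' ≫ (α_ (i : C) Y Y').hom) =
        (α_ (i : C) Y Y').inv ≫ (P.p a ≫ P.q a) ▷ Y' ≫ (α_ (i : C) Y Y').hom := fun a => by
      have h := (Q a).total
      have h' : ∀ b, ((α_ (i : C) Y Y').inv ≫ P.p a ▷ Y' ≫ (Q a).p b) ≫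
          ((Q a).q b ≫ P.q a ▷ Y' ≫ (α_ (i : C) Y Y').hom) =
          (α_ (i : C) Y Y').inv ≫ P.p a ▷ Y' ≫ ((Q a).p b ≫ (Q a).q b) ≫
          P.q a ▷ Y' ≫ (α_ (i : C) Y Y').hom := fun b => by simp
      simp only [h', ← Preadditive.comp_sum, ← Preadditive.sum_comp, h]
      simp
    simp only [this, ← Preadditive.comp_sum, ← Preadditive.sum_comp, ← sum_whiskerRight, P.total]
    simp
  have := sum_bendMap_change k hI X (𝟙 ((i : C) ⊗ (Y ⊗ Y'))) _
    (fun x : (Σ a : Fin P.n, Fin (Q a).n) => (Q x.1).label x.2) _ _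
    (partition k hI ((i : C) ⊗ (Y ⊗ Y'))).total
    (fun x => (α_ (i : C) Y Y').inv ≫ P.p x.1 ▷ Y' ≫ (Q x.1).p x.2)
    (fun x => (Q x.1).q x.2 ≫ P.q x.1 ▷ Y' ≫ (α_ (i : C) Y Y').hom) htot
  simp only [Category.id_comp, Category.comp_id] at this
  rw [freeι_freeBraid, this, Fintype.sum_sigma]
  simp only [bendMap_tensor]
  have h3 : freeι X i ▷ (Y ⊗ Y') ≫ (α_ _ _ _).inv ≫ freeBraid k hI X Y ▷ Y' =
      (α_ _ _ _).inv ≫ (freeι X i ▷ Y ≫ freeBraid k hI X Y) ▷ Y' := by simp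
  rw [reassoc_of% h3, freeι_freeBraid, sum_whiskerRight, Preadditive.sum_comp, Preadditive.comp_sum]
  refine Finset.sum_congr rfl fun a _ => ?_
  have h4 : ∀ {U : C} (g : U ⟶ Y ⊗ (dual (P.label a : C) ⊗ (X ⊗ (P.label a : C)))),
      (g ≫ Y ◁ freeι X (P.label a)) ▷ Y' ≫ (α_ _ _ _).hom ≫ Y ◁ freeBraid k hI X Y' =
      g ▷ Y' ≫ (α_ _ _ _).hom ≫ Y ◁ (freeι X (P.label a) ▷ Y' ≫ freeBraid k hI X Y') :=
    fun g => by simp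
  rw [reassoc_of% h4, freeι_freeBraid, whiskerLeft_sum]
  simp only [Preadditive.sum_comp, Preadditive.comp_sum]
  refine Finset.sum_congr rfl fun b _ => ?_
  simp [P, Q]

/-- The free half braiding `F(X) = (Z(X), ς_X)`, an object of the center. -/
noncomputable def freeHalfBraiding (X : C) : Center C :=
  ⟨freeObj I X,
    { β := fun Y =>
        { hom := freeBraid k hI X Y
          inv := braidInv (freeBraid k hI X) Y
          hom_inv_id := braid_comp_inv _ (freeBraid_naturality k hI X) (freeBraid_tensor k hI X)
            (freeBraid_unit k hI X) Y
          inv_hom_id := inv_comp_braid _ (freeBraid_naturality k hI X) (freeBraid_tensor k hI X)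
            (freeBraid_unit k hI X) Y }
      monoidal := freeBraid_tensor k hI X
      naturality := freeBraid_naturality k hI X }⟩

end FreeCenter

end FusionCenter

/-!
The functor `F` is left adjoint to the forgetful functor from the center, so every morphism
`F(X) ⟶ (A, σ)` factors through the counit `F(A) ⟶ (A, σ)`. Hence `(A, σ)` is a retract of some
`F(X)` if and only if this counit splits.

Given weights `c : I → k`, consider the morphism `A ⟶ Z(A)` that, for each `i ∈ I`, creates a right
loop labelled by `i`, moves `A` into it with `σ`, and multiplies by `c_i`. Composed with the counit
it is the scalar `∑ i, c_i dim_l(i)`. It is a morphism in the center if `c_i = dim_r(i)`, because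
the right trace is cyclic, and then the scalar is `dim(C)`; so the counit splits when `dim(C)` is
invertible.

Conversely, every section of the counit at the unit object is of this form, since
`Hom(𝟙, i^* ⊗ i) ≅ End(i) = k`. Being a morphism in the center then forces
`dim_r(i) c_𝟙 = dim_r(𝟙) c_i`, and `∑ i, c_i dim_l(i) = 1` yields `dim(C) c_𝟙 = dim_r(𝟙)`, which is
invertible with inverse `dim_l(𝟙)`.
-/

namespace FusionCenter

section Duality

variable {C : Type u} [Category.{v} C] [MonoidalCategory C]

lemma leftMate_id {X X' : C} (pX : ExactPairing X X') : leftMate pX pX (𝟙 X) = 𝟙 X' :=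
  @rightAdjointMate_id C _ _ X ⟨X'⟩

lemma leftMate_comp {X X' Y Y' Z Z' : C} (pX : ExactPairing X X') (pY : ExactPairing Y Y')
    (pZ : ExactPairing Z Z') (f : X ⟶ Y) (g : Y ⟶ Z) :
    leftMate pX pZ (f ≫ g) = leftMate pY pZ g ≫ leftMate pX pY f :=
  @comp_rightAdjointMate C _ _ X Y Z ⟨X'⟩ ⟨Y'⟩ ⟨Z'⟩ f g

lemma leftMate_sum [Preadditive C] [MonoidalPreadditive C] {X X' Y Y' : C}
    (pX : ExactPairing X X') (pY : ExactPairing Y Y') {A : Type*} (s : Finset A)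
    (f : A → (X ⟶ Y)) : leftMate pX pY (∑ a ∈ s, f a) = ∑ a ∈ s, leftMate pX pY (f a) := by
  simp only [leftMate, rightAdjointMate, sum_whiskerRight, whiskerLeft_sum, Preadditive.comp_sum,
    Preadditive.sum_comp]

variable [PivotalCategory C]

instance leftDualPairing (X : C) : ExactPairing X (dual X) :=
  PivotalCategory.leftPairing X

instance rightDualPairing (X : C) : ExactPairing (dual X) X :=
  PivotalCategory.rightPairing X

lemma bend_eq_tensorHomEquiv {i j Y : C} (q : j ⟶ i ⊗ Y) :
    bend q = tensorRightHomEquiv (dual i) j (dual j) Y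
      ((tensorLeftHomEquiv j i (dual i) Y).symm q) := by
  change _ = (ρ_ _).inv ≫ dual i ◁ lcoev j ≫ (α_ _ _ _).inv ≫
    (dual i ◁ q ≫ (α_ _ _ _).inv ≫ lev i ▷ Y ≫ (λ_ Y).hom) ▷ dual j
  rw [bend]
  monoidal

lemma bend_bijective (i j Y : C) :
    Function.Bijective (bend : (j ⟶ i ⊗ Y) → (dual i ⟶ Y ⊗ dual j)) := by
  rw [funext bend_eq_tensorHomEquiv]
  exact ((tensorLeftHomEquiv j i (dual i) Y).symm.trans
    (tensorRightHomEquiv (dual i) j (dual j) Y)).bijective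

lemma exists_eq_bend_comp_leftUnitor {i j : C} (f : dual i ⟶ dual j) :
    ∃ g : j ⟶ i, f = bend (g ≫ (ρ_ i).inv) ≫ (λ_ (dual j)).hom := by
  obtain ⟨h, hh⟩ := (bend_bijective i j (𝟙_ C)).2 (f ≫ (λ_ (dual j)).inv)
  exact ⟨h ≫ (ρ_ i).hom, by simp [hh]⟩

/-- The morphism `Y ⊗ j^* ⟶ i^*` obtained from `p : i ⊗ Y ⟶ j` by duality. It is the counterpart
of `bend`, but uses the right evaluation of `j` and the right coevaluation of `i`. -/
def cobend {i j Y : C} (p : i ⊗ Y ⟶ j) : Y ⊗ dual j ⟶ dual i :=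
  (tensorRightHomEquiv Y (dual j) j (dual i)).symm (tensorLeftHomEquiv Y (dual i) i j p)

lemma rcoev_cobend {i j Y : C} (p : i ⊗ Y ⟶ j) :
    (ρ_ Y).inv ≫ Y ◁ rcoev j ≫ (α_ _ _ _).inv ≫ cobend p ▷ j =
      (λ_ Y).inv ≫ rcoev i ▷ Y ≫ (α_ _ _ _).hom ≫ dual i ◁ p :=
  (tensorRightHomEquiv Y (dual j) j (dual i)).apply_symm_apply _

lemma whiskerLeft_cobend_rev {i j Y : C} (p : i ⊗ Y ⟶ j) :
    i ◁ cobend p ≫ rev i = (α_ i Y (dual j)).inv ≫ p ▷ dual j ≫ rev j := by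
  have h : cobend p = ((λ_ Y).inv ≫ rcoev i ▷ Y ≫ (α_ _ _ _).hom ≫ dual i ◁ p) ▷ dual j ≫
    (α_ _ _ _).hom ≫ dual i ◁ rev j ≫ (ρ_ _).hom := rfl
  rw [h]
  calc
    _ = 𝟙 _ ⊗≫ i ◁ rcoev i ▷ (Y ⊗ dual j) ⊗≫
          ((i ⊗ dual i) ◁ (p ▷ dual j ≫ rev j) ≫ rev i ▷ 𝟙_ C) ⊗≫ 𝟙 _ := by monoidal
    _ = 𝟙 _ ⊗≫ (i ◁ rcoev i ⊗≫ rev i ▷ i) ▷ (Y ⊗ dual j) ⊗≫ (p ▷ dual j ≫ rev j) ⊗≫ 𝟙 _ := by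
      rw [whisker_exchange]; monoidal
    _ = _ := by rw [rev_rcoev]; monoidal

/-- Cyclicity of the right trace: on the left the loop is closed at `i`, on the right at `j`. -/
lemma lcoev_bend_cobend_rev {i j Y : C} (q : j ⟶ i ⊗ Y) (p : i ⊗ Y ⟶ j) :
    lcoev i ≫ i ◁ (bend q ≫ cobend p) ≫ rev i = lcoev j ≫ (q ≫ p) ▷ dual j ≫ rev j := by
  rw [whiskerLeft_comp, Category.assoc, whiskerLeft_cobend_rev, reassoc_of% (lcoev_bend q),
    Iso.hom_inv_id_assoc, comp_whiskerRight, Category.assoc]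

lemma bend_lev {i j Y : C} (q : j ⟶ i ⊗ Y) (p : i ⊗ Y ⟶ j) :
    dual i ◁ p ≫ bend q ▷ j ≫ (α_ _ _ _).hom ≫ Y ◁ lev j =
      dual i ◁ (p ≫ q) ≫ (α_ _ _ _).inv ≫ lev i ▷ Y ≫ (λ_ Y).hom ≫ (ρ_ Y).inv := by
  have h : bend q ▷ j ≫ (α_ _ _ _).hom ≫ Y ◁ lev j ≫ (ρ_ Y).hom =
      (tensorLeftHomEquiv j i (dual i) Y).symm q := by
    rw [bend_eq_tensorHomEquiv]
    exact (tensorRightHomEquiv (dual i) j (dual j) Y).symm_apply_apply _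
  rw [← cancel_mono (ρ_ Y).hom]
  simp only [Category.assoc, h, Iso.inv_hom_id, Category.comp_id, whiskerLeft_comp]
  rfl

lemma lev_unit_lcoev_unit : lev (𝟙_ C) ≫ lcoev (𝟙_ C) = (ρ_ _).hom ≫ (λ_ _).inv := by
  calc
    _ = 𝟙 _ ⊗≫ (lev (𝟙_ C) ▷ 𝟙_ C ≫ 𝟙_ C ◁ lcoev (𝟙_ C)) ⊗≫ 𝟙 _ := by monoidal
    _ = 𝟙 _ ⊗≫ (dual (𝟙_ C) ◁ lcoev (𝟙_ C) ⊗≫ lev (𝟙_ C) ▷ dual (𝟙_ C)) ⊗≫ 𝟙 _ := by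
      rw [← whisker_exchange]; monoidal
    _ = _ := by rw [lev_lcoev]; monoidal

lemma rcoev_unit_rev_unit :
    rcoev (𝟙_ C) ≫ (ρ_ _).hom ≫ (λ_ _).inv ≫ rev (𝟙_ C) = 𝟙 (𝟙_ C) := by
  have h := congrArg (fun f => (λ_ (𝟙_ C)).inv ≫ f ≫ (λ_ (𝟙_ C)).hom) (rev_rcoev (𝟙_ C))
  refine Eq.trans ?_ (h.trans ?_) <;> monoidal

end Duality

section LinearDuality

variable {C : Type u} [Category.{v} C] [MonoidalCategory C] [PivotalCategory C]
  [Preadditive C] [MonoidalPreadditive C]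

lemma bend_zero {i j Y : C} : bend (0 : j ⟶ i ⊗ Y) = 0 := by
  simp [bend]

lemma bend_smul {k : Type w} [CommRing k] [Linear k C] [MonoidalLinear k C] {i j Y : C} (c : k)
    (q : j ⟶ i ⊗ Y) : bend (c • q) = c • bend q := by
  simp [bend]

end LinearDuality

section Dimension

variable {k : Type w} [CommRing k] {C : Type u} [Category.{v} C] [Preadditive C] [Linear k C]
  [MonoidalCategory C] [HasFiniteBiproducts C] [MonoidalPreadditive C] [MonoidalLinear k C]
  [IsFusionCategory k C]

lemma unitCoeff_smul_id (f : 𝟙_ C ⟶ 𝟙_ C) : unitCoeff k f • 𝟙 (𝟙_ C) = f :=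
  (Equiv.ofBijective _ (IsFusionCategory.scalar_unit (k := k) (C := C))).apply_symm_apply f

variable [PivotalCategory C]

lemma rightDim_smul_id (X : C) : rightDim k X • 𝟙 (𝟙_ C) = lcoev X ≫ rev X := by
  simp [rightDim, unitCoeff_smul_id, rightTrace]

lemma leftDim_smul_id (X : C) : leftDim k X • 𝟙 (𝟙_ C) = rcoev X ≫ lev X := by
  simp [leftDim, unitCoeff_smul_id, leftTrace]

lemma leftDim_unit_mul_rightDim_unit : leftDim k (𝟙_ C) * rightDim k (𝟙_ C) = 1 := by
  apply (IsFusionCategory.scalar_unit (k := k) (C := C)).1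
  calc
    (leftDim k (𝟙_ C) * rightDim k (𝟙_ C)) • 𝟙 (𝟙_ C) =
        (leftDim k (𝟙_ C) • 𝟙 (𝟙_ C)) ≫ (rightDim k (𝟙_ C) • 𝟙 (𝟙_ C)) := by
      simp [smul_smul, mul_comm]
    _ = rcoev (𝟙_ C) ≫ (lev (𝟙_ C) ≫ lcoev (𝟙_ C)) ≫ rev (𝟙_ C) := by
      simp [leftDim_smul_id, rightDim_smul_id]
    _ = (1 : k) • 𝟙 (𝟙_ C) := by
      simp [lev_unit_lcoev_unit, rcoev_unit_rev_unit]

lemma mul_rightDim_eq {i j Y : C} {q : j ⟶ i ⊗ Y} {p : i ⊗ Y ⟶ j} {a b : k}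
    (ha : bend q ≫ cobend p = a • 𝟙 _) (hb : q ≫ p = b • 𝟙 _) :
    a * rightDim k i = b * rightDim k j := by
  apply (IsFusionCategory.scalar_unit (k := k) (C := C)).1
  simpa [ha, hb, mul_smul, rightDim_smul_id] using lcoev_bend_cobend_rev q p

end Dimension

section Scalar

variable {k : Type w} [CommRing k] {C : Type u} [Category.{v} C] [Preadditive C] [Linear k C]
  [MonoidalCategory C] {I : Finset C}

lemma IsRepresentativeSet.hom_eq_zero [HasFiniteBiproducts C] [MonoidalPreadditive C]
    [MonoidalLinear k C] [IsFusionCategory k C] (hI : IsRepresentativeSet k I) {i j : I}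
    (hij : i ≠ j) (f : (i : C) ⟶ j) : f = 0 := by
  refine IsFusionCategory.hom_eq_zero (hI.scalar _ i.2) (hI.scalar _ j.2) ⟨fun e => hij ?_⟩ f
  exact Subtype.ext ((hI.existsUnique_iso (i : C) (hI.scalar _ i.2)).unique
    ⟨i.2, ⟨Iso.refl _⟩⟩ ⟨j.2, ⟨e⟩⟩)

variable [PivotalCategory C] [MonoidalPreadditive C] [MonoidalLinear k C]

lemma IsScalar.exists_eq_smul_id_dual {i : C} (hi : IsScalar k i) (f : dual i ⟶ dual i) :
    ∃ c : k, f = c • 𝟙 _ := by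
  obtain ⟨g, rfl⟩ := exists_eq_bend_comp_leftUnitor f
  obtain ⟨c, rfl⟩ := hi.2 g
  exact ⟨c, by simp [bend_smul, bend_unit]⟩

variable [HasFiniteBiproducts C] [IsFusionCategory k C]

lemma IsRepresentativeSet.dual_hom_eq_zero (hI : IsRepresentativeSet k I) {i j : I} (hij : i ≠ j)
    (f : dual (i : C) ⟶ dual (j : C)) : f = 0 := by
  obtain ⟨g, rfl⟩ := exists_eq_bend_comp_leftUnitor f
  simp [hI.hom_eq_zero hij.symm g, bend_zero]

/-- Every object is a direct sum of duals of elements of `I`, being the dual of its own dual. -/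
lemma IsRepresentativeSet.hom_ext_of_dual (hI : IsRepresentativeSet k I) {W V : C} {g g' : W ⟶ V}
    (h : ∀ (i : I) (f : dual (i : C) ⟶ W), f ≫ g = f ≫ g') : g = g' := by
  let P := partition k hI (dual W)
  have hW : 𝟙 W = ∑ a, leftMate (leftDualPairing _) (rightDualPairing W) (P.q a) ≫
      leftMate (rightDualPairing W) (leftDualPairing _) (P.p a) := by
    simp only [← leftMate_comp, ← leftMate_sum, P.total, leftMate_id]
  rw [← Category.id_comp g, ← Category.id_comp g', hW, Preadditive.sum_comp, Preadditive.sum_comp]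
  exact Finset.sum_congr rfl fun a _ => by rw [Category.assoc, h, Category.assoc]

lemma IsRepresentativeSet.rightDim_smul_bend_cobend_bend (hI : IsRepresentativeSet k I) {i j : I}
    {Y : C} (h q : (j : C) ⟶ i ⊗ Y) (p : (i : C) ⊗ Y ⟶ j) :
    rightDim k (i : C) • ((bend h ≫ cobend p) ≫ bend q) =
      rightDim k (j : C) • bend ((h ≫ p) ≫ q) := by
  obtain ⟨a, ha⟩ := (hI.scalar _ i.2).exists_eq_smul_id_dual (bend h ≫ cobend p)
  obtain ⟨b, hb⟩ := (hI.scalar _ j.2).2 (h ≫ p)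
  have hab : a * rightDim k (i : C) = b * rightDim k (j : C) := mul_rightDim_eq ha hb.symm
  simp only [ha, ← hb, Linear.smul_comp, Category.id_comp, bend_smul, smul_smul, mul_comm _ a,
    mul_comm _ b, hab]

end Scalar

namespace ScalarPartition

variable {C : Type u} [Category.{v} C] [Preadditive C] {I : Finset C} {Y : C}

open Classical in
/-- The projection of `Y` onto its `a`-th summand, as a morphism to `j`, if that summand is labelled
by `j`; zero otherwise. -/
noncomputable def proj (P : ScalarPartition I Y) (j : I) (a : Fin P.n) : Y ⟶ (j : C) :=
  if h : P.label a = j then P.p a ≫ eqToHom (congrArg Subtype.val h) else 0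

open Classical in
/-- The inclusion into `Y` of its `a`-th summand, as a morphism from `j`, if that summand is
labelled by `j`; zero otherwise. -/
noncomputable def incl (P : ScalarPartition I Y) (j : I) (a : Fin P.n) : (j : C) ⟶ Y :=
  if h : P.label a = j then eqToHom (congrArg Subtype.val h.symm) ≫ P.q a else 0

lemma proj_label (P : ScalarPartition I Y) (a : Fin P.n) : P.proj (P.label a) a = P.p a := by
  simp [proj]

lemma incl_label (P : ScalarPartition I Y) (a : Fin P.n) : P.incl (P.label a) a = P.q a := by
  simp [incl]

lemma proj_of_ne (P : ScalarPartition I Y) {j : I} {a : Fin P.n} (h : P.label a ≠ j) :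
    P.proj j a = 0 :=
  dif_neg h

lemma sum_proj_incl (P : ScalarPartition I Y) : ∑ j, ∑ a, P.proj j a ≫ P.incl j a = 𝟙 Y := by
  rw [Finset.sum_comm, ← P.total]
  refine Finset.sum_congr rfl fun a _ => ?_
  rw [Fintype.sum_eq_single (P.label a) fun j hj => by rw [P.proj_of_ne hj.symm, zero_comp],
    proj_label, incl_label]

lemma sum_comp_proj_incl {k : Type w} [CommRing k] [Linear k C] [MonoidalCategory C]
    [HasFiniteBiproducts C] [MonoidalPreadditive C] [MonoidalLinear k C] [IsFusionCategory k C]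
    (hI : IsRepresentativeSet k I) (P : ScalarPartition I Y) {j : I} (h : (j : C) ⟶ Y) :
    ∑ a, (h ≫ P.proj j a) ≫ P.incl j a = h := by
  calc
    _ = ∑ l, ∑ a, (h ≫ P.proj l a) ≫ P.incl l a := by
      symm
      refine Fintype.sum_eq_single j fun l hl => ?_
      simp only [hI.hom_eq_zero hl.symm (h ≫ P.proj l _), zero_comp, Finset.sum_const_zero]
    _ = h := by
      simp only [Category.assoc, ← Preadditive.comp_sum, P.sum_proj_incl, Category.comp_id]

end ScalarPartition

section Transfer

variable {k : Type w} [CommRing k] {C : Type u} [Category.{v} C] [Preadditive C] [Linear k C]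
  [MonoidalCategory C] [HasFiniteBiproducts C] [MonoidalPreadditive C] [MonoidalLinear k C]
  [IsFusionCategory k C] [PivotalCategory C] {I : Finset C} (hI : IsRepresentativeSet k I)

/-- The endomorphism `∑_i c_i ∑_a cobend p_a ≫ bend q_a` of `Y ⊗ j^*`, where `(p_a, q_a)_a` is
a `j`-decomposition of `i ⊗ Y`. If it equals `c_j • 𝟙` for all `j` and `Y`, then the weights `c`
define morphisms in the center from any half braiding `(A, σ)` to `F(A)`. -/
noncomputable def transfer (c : I → k) (j : I) (Y : C) :
    Y ⊗ dual (j : C) ⟶ Y ⊗ dual (j : C) :=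
  ∑ i : I, c i • ∑ a, cobend ((partition k hI ((i : C) ⊗ Y)).proj j a) ≫
    bend ((partition k hI ((i : C) ⊗ Y)).incl j a)

lemma rightDim_smul_sum_bend_cobend_bend {i j : I} {Y : C} (h : (j : C) ⟶ i ⊗ Y) :
    rightDim k (i : C) • ∑ a, (bend h ≫ cobend ((partition k hI ((i : C) ⊗ Y)).proj j a)) ≫
      bend ((partition k hI ((i : C) ⊗ Y)).incl j a) = rightDim k (j : C) • bend h := by
  rw [Finset.smul_sum]
  simp only [hI.rightDim_smul_bend_cobend_bend]
  rw [← Finset.smul_sum, ← bend_sum, ScalarPartition.sum_comp_proj_incl hI]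

lemma bend_comp_transfer (c : I → k) {i j : I} {Y : C} (h : (j : C) ⟶ i ⊗ Y) :
    bend h ≫ transfer hI c j Y =
      c i • ∑ a, (bend h ≫ cobend ((partition k hI ((i : C) ⊗ Y)).proj j a)) ≫
        bend ((partition k hI ((i : C) ⊗ Y)).incl j a) := by
  simp only [transfer, Preadditive.comp_sum, Linear.comp_smul, ← Category.assoc]
  refine Fintype.sum_eq_single i fun l hl => ?_
  simp only [hI.dual_hom_eq_zero hl.symm (bend h ≫ cobend _), zero_comp, Finset.sum_const_zero,
    smul_zero]

lemma transfer_rightDim (j : I) (Y : C) :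
    transfer hI (fun i => rightDim k (i : C)) j Y = rightDim k (j : C) • 𝟙 _ := by
  refine hI.hom_ext_of_dual fun i f => ?_
  obtain ⟨h, rfl⟩ := (bend_bijective (i : C) j Y).2 f
  rw [bend_comp_transfer, rightDim_smul_sum_bend_cobend_bend, Linear.comp_smul, Category.comp_id]

lemma rightDim_mul_smul_of_transfer_eq {c : I → k} {i j : I} {Y : C}
    (hc : transfer hI c j Y = c j • 𝟙 _) (h : (j : C) ⟶ i ⊗ Y) :
    (rightDim k (i : C) * c j) • h = (rightDim k (j : C) * c i) • h := by
  apply (bend_bijective (i : C) j Y).1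
  have hh : bend h ≫ transfer hI c j Y = c j • bend h := by simp [hc]
  rw [bend_smul, bend_smul, mul_smul, ← hh, bend_comp_transfer, smul_comm,
    rightDim_smul_sum_bend_cobend_bend, smul_smul, mul_comm (c i)]

end Transfer

section HalfBraiding

variable {C : Type u} [Category.{v} C] [MonoidalCategory C]

lemma halfBraiding_unit {A : C} (σ : HalfBraiding A) :
    (σ.β (𝟙_ C)).hom = (ρ_ A).hom ≫ (λ_ A).inv := by
  have hnat := σ.naturality (λ_ (𝟙_ C)).hom
  rw [σ.monoidal] at hnat
  have hidem : (σ.β (𝟙_ C)).hom =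
      (σ.β (𝟙_ C)).hom ≫ (λ_ A).hom ≫ (ρ_ A).inv ≫ (σ.β (𝟙_ C)).hom := by
    calc
      _ = A ◁ (λ_ (𝟙_ C)).inv ≫ A ◁ (λ_ (𝟙_ C)).hom ≫ (σ.β (𝟙_ C)).hom := by
        rw [whiskerLeft_inv_hom_assoc]
      _ = 𝟙 _ ⊗≫ (σ.β (𝟙_ C)).hom ▷ 𝟙_ C ⊗≫ 𝟙_ C ◁ (σ.β (𝟙_ C)).hom ⊗≫ 𝟙 _ := by
        rw [hnat]; monoidal
      _ = _ := by monoidal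
  have hid := (cancel_epi (σ.β (𝟙_ C)).hom).1 ((Category.comp_id _).trans hidem)
  rw [← cancel_epi (ρ_ A).inv, ← cancel_epi (λ_ A).hom, ← hid]
  simp

variable [PivotalCategory C]

/-- The component `i^* ⊗ A ⊗ i ⟶ A` of the counit of the free half braiding adjunction. -/
def counitComp {A : C} (σ : HalfBraiding A) (i : C) : dual i ⊗ (A ⊗ i) ⟶ A :=
  dual i ◁ (σ.β i).hom ≫ (α_ _ _ _).inv ≫ lev i ▷ A ≫ (λ_ A).hom

/-- The morphism `A ⟶ i^* ⊗ A ⊗ i` that creates a right loop `𝟙 ⟶ i^* ⊗ i` and moves `A` into it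
with the half braiding. The sections of the counit are sums of multiples of these. -/
def sectionComp {A : C} (σ : HalfBraiding A) (i : C) : A ⟶ dual i ⊗ (A ⊗ i) :=
  (ρ_ A).inv ≫ A ◁ rcoev i ≫ (α_ _ _ _).inv ≫ (σ.β (dual i)).hom ▷ i ≫ (α_ _ _ _).hom

lemma sectionComp_counitComp {A : C} (σ : HalfBraiding A) (i : C) :
    sectionComp σ i ≫ counitComp σ i = (ρ_ A).inv ≫ A ◁ (rcoev i ≫ lev i) ≫ (ρ_ A).hom := by
  have hnat := σ.naturality (lev i)
  rw [σ.monoidal, halfBraiding_unit] at hnat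
  calc
    _ = (ρ_ A).inv ≫ A ◁ rcoev i ≫ (((α_ _ _ _).inv ≫ (σ.β (dual i)).hom ▷ i ≫
        (α_ _ _ _).hom ≫ dual i ◁ (σ.β i).hom ≫ (α_ _ _ _).inv) ≫ lev i ▷ A) ≫
        (λ_ A).hom := by simp [sectionComp, counitComp]
    _ = _ := by rw [← hnat]; simp

lemma sectionComp_bendMap {A : C} (σ : HalfBraiding A) {i j Y : C} (q : j ⟶ i ⊗ Y)
    (p : i ⊗ Y ⟶ j) :
    sectionComp σ i ▷ Y ≫ bendMap A q p =
      ((σ.β Y).hom ≫ Y ◁ sectionComp σ j ≫ (α_ _ _ _).inv) ≫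
        (cobend p ≫ bend q) ▷ (A ⊗ j) ≫ (α_ _ _ _).hom := by
  have hnat := σ.naturality (cobend p)
  rw [σ.monoidal] at hnat
  dsimp only [sectionComp, bendMap]
  calc
    _ = 𝟙 _ ⊗≫ A ◁ rcoev i ▷ Y ⊗≫ ((σ.β (dual i)).hom ▷ (i ⊗ Y) ≫ (dual i ⊗ A) ◁ p) ⊗≫
          bend q ▷ (A ⊗ j) ⊗≫ 𝟙 _ := by monoidal
    _ = 𝟙 _ ⊗≫ A ◁ ((λ_ Y).inv ≫ rcoev i ▷ Y ≫ (α_ _ _ _).hom ≫ dual i ◁ p) ⊗≫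
          (σ.β (dual i)).hom ▷ j ⊗≫ bend q ▷ (A ⊗ j) ⊗≫ 𝟙 _ := by
      rw [← whisker_exchange]; monoidal
    _ = 𝟙 _ ⊗≫ A ◁ Y ◁ rcoev j ⊗≫ (A ◁ cobend p ≫ (σ.β (dual i)).hom) ▷ j ⊗≫
          bend q ▷ (A ⊗ j) ⊗≫ 𝟙 _ := by
      rw [← rcoev_cobend]; monoidal
    _ = 𝟙 _ ⊗≫ ((A ⊗ Y) ◁ rcoev j ≫ (σ.β Y).hom ▷ (dual j ⊗ j)) ⊗≫
          Y ◁ (σ.β (dual j)).hom ▷ j ⊗≫ (cobend p ≫ bend q) ▷ (A ⊗ j) ⊗≫ 𝟙 _ := by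
      rw [hnat]; monoidal
    _ = _ := by rw [whisker_exchange]; monoidal

lemma bendMap_counitComp {A : C} (σ : HalfBraiding A) {i j Y : C} (q : j ⟶ i ⊗ Y)
    (p : i ⊗ Y ⟶ j) :
    bendMap A q p ≫ Y ◁ counitComp σ j =
      (α_ _ _ _).hom ≫ dual i ◁ ((α_ _ _ _).hom ≫ (σ.β (i ⊗ Y)).hom ≫ (p ≫ q) ▷ A) ≫
        𝟙 _ ⊗≫ lev i ▷ (Y ⊗ A) ⊗≫ 𝟙 _ := by
  dsimp only [counitComp, bendMap]
  calc
    _ = 𝟙 _ ⊗≫ dual i ◁ A ◁ p ⊗≫ (bend q ▷ (A ⊗ j) ≫ (Y ⊗ dual j) ◁ (σ.β j).hom) ⊗≫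
          Y ◁ lev j ▷ A ⊗≫ 𝟙 _ := by monoidal
    _ = 𝟙 _ ⊗≫ dual i ◁ (A ◁ p ≫ (σ.β j).hom) ⊗≫ bend q ▷ (j ⊗ A) ⊗≫
          Y ◁ lev j ▷ A ⊗≫ 𝟙 _ := by
      rw [← whisker_exchange]; monoidal
    _ = 𝟙 _ ⊗≫ dual i ◁ (σ.β (i ⊗ Y)).hom ⊗≫
          (dual i ◁ p ≫ bend q ▷ j ≫ (α_ _ _ _).hom ≫ Y ◁ lev j) ▷ A ⊗≫ 𝟙 _ := by
      rw [σ.naturality]; monoidal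
    _ = _ := by rw [bend_lev]; monoidal

lemma counitComp_halfBraiding {A : C} (σ : HalfBraiding A) (i Y : C) :
    counitComp σ i ▷ Y ≫ (σ.β Y).hom =
      (α_ _ _ _).hom ≫ dual i ◁ ((α_ _ _ _).hom ≫ (σ.β (i ⊗ Y)).hom) ≫
        𝟙 _ ⊗≫ lev i ▷ (Y ⊗ A) ⊗≫ 𝟙 _ := by
  rw [σ.monoidal]
  dsimp only [counitComp]
  calc
    _ = 𝟙 _ ⊗≫ dual i ◁ (σ.β i).hom ▷ Y ⊗≫ (lev i ▷ (A ⊗ Y) ≫ 𝟙_ C ◁ (σ.β Y).hom) ⊗≫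
          𝟙 _ := by monoidal
    _ = _ := by rw [← whisker_exchange]; monoidal

lemma whiskerLeft_whiskerRight_counitComp {X A : C} (σ : HalfBraiding A) (i : C) (t : X ⟶ A) :
    dual i ◁ t ▷ i ≫ counitComp σ i =
      (tensorLeftHomEquiv (X ⊗ i) i (dual i) A).symm (t ▷ i ≫ (σ.β i).hom) := by
  rw [tensorLeftHomEquiv_symm_naturality]
  rfl

end HalfBraiding

section UnitHalfBraiding

variable {C : Type u} [Category.{v} C] [MonoidalCategory C]

variable (C) in
/-- The half braiding of the unit object of the center, as a half braiding of `𝟙_ C`. -/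
noncomputable def unitHalfBraiding : HalfBraiding (𝟙_ C) := (𝟙_ (Center C)).2

lemma unitHalfBraiding_β_hom (Y : C) :
    ((unitHalfBraiding C).β Y).hom = (λ_ Y).hom ≫ (ρ_ Y).inv := by
  simp [unitHalfBraiding, Center.tensorUnit_β]

variable [PivotalCategory C]

lemma sectionComp_unit (i : C) :
    sectionComp (unitHalfBraiding C) i = rcoev i ≫ dual i ◁ (λ_ i).inv := by
  simp only [sectionComp, unitHalfBraiding_β_hom]
  monoidal

lemma whiskerLeft_sectionComp_unit_injective {j Y W : C} {g g' : Y ⊗ dual j ⟶ W}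
    (h : Y ◁ sectionComp (unitHalfBraiding C) j ≫ (α_ _ _ _).inv ≫ g ▷ (𝟙_ C ⊗ j) =
      Y ◁ sectionComp (unitHalfBraiding C) j ≫ (α_ _ _ _).inv ≫ g' ▷ (𝟙_ C ⊗ j)) : g = g' := by
  have hg : ∀ g : Y ⊗ dual j ⟶ W, tensorRightHomEquiv Y (dual j) j W g =
      (ρ_ Y).inv ≫ (Y ◁ sectionComp (unitHalfBraiding C) j ≫ (α_ _ _ _).inv ≫
        g ▷ (𝟙_ C ⊗ j)) ≫ W ◁ (λ_ j).hom := fun g => by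
    change (ρ_ Y).inv ≫ Y ◁ rcoev j ≫ (α_ _ _ _).inv ≫ g ▷ j = _
    rw [sectionComp_unit]
    monoidal
  apply (tensorRightHomEquiv Y (dual j) j W).injective
  rw [hg, hg, h]

end UnitHalfBraiding

section FreeComponents

variable {C : Type u} [Category.{v} C] [MonoidalCategory C] [PivotalCategory C]

lemma whiskerLeft_whiskerRight_bendMap {X X' i j Y Y' : C} (t : X ⟶ X') (q : j ⟶ i ⊗ Y')
    (p : i ⊗ Y ⟶ j) :
    (dual i ◁ t ▷ i) ▷ Y ≫ bendMap X' q p = bendMap X q p ≫ Y' ◁ dual j ◁ t ▷ j := by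
  dsimp only [bendMap]
  calc
    _ = 𝟙 _ ⊗≫ dual i ◁ (t ▷ (i ⊗ Y) ≫ X' ◁ p) ⊗≫ bend q ▷ (X' ⊗ j) ⊗≫ 𝟙 _ := by monoidal
    _ = 𝟙 _ ⊗≫ dual i ◁ X ◁ p ⊗≫ (dual i ◁ (t ▷ j) ≫ bend q ▷ (X' ⊗ j)) ⊗≫ 𝟙 _ := by
      rw [← whisker_exchange]; monoidal
    _ = _ := by rw [whisker_exchange]; monoidal

lemma lcoev_unit_bendMap (X i : C) :
    (λ_ (X ⊗ i)).inv ≫ lcoev (𝟙_ C) ▷ (X ⊗ i) ≫ 𝟙 _ ⊗≫ bendMap X (λ_ i).inv (λ_ i).hom =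
      (λ_ _).inv ≫ lcoev i ▷ (X ⊗ i) ≫ (α_ _ _ _).hom := by
  dsimp only [bendMap]
  calc
    _ = 𝟙 _ ⊗≫ (lcoev (𝟙_ C) ≫ 𝟙_ C ◁ bend (λ_ i).inv) ▷ (X ⊗ i) ⊗≫ 𝟙 _ := by monoidal
    _ = _ := by rw [lcoev_bend]; monoidal

variable [Preadditive C] [HasFiniteBiproducts C] {I : Finset C}

/-- The morphism out of `Z(X)` with the given components. -/
noncomputable def freeDesc {X W : C} (f : ∀ i : I, dual (i : C) ⊗ (X ⊗ (i : C)) ⟶ W) :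
    freeObj I X ⟶ W :=
  biproduct.desc f

lemma freeι_freeDesc {X W : C} (f : ∀ i : I, dual (i : C) ⊗ (X ⊗ (i : C)) ⟶ W) (i : I) :
    freeι X i ≫ freeDesc f = f i :=
  biproduct.ι_desc f i

/-- The morphism into `Z(X)` with the given components. -/
noncomputable def freeLift {X W : C} (f : ∀ i : I, W ⟶ dual (i : C) ⊗ (X ⊗ (i : C))) :
    W ⟶ freeObj I X :=
  biproduct.lift f

lemma freeLift_freeπ {X W : C} (f : ∀ i : I, W ⟶ dual (i : C) ⊗ (X ⊗ (i : C))) (i : I) :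
    freeLift f ≫ freeπ X i = f i :=
  biproduct.lift_π f i

lemma freeLift_freeDesc {X W W' : C} (f : ∀ i : I, W ⟶ dual (i : C) ⊗ (X ⊗ (i : C)))
    (g : ∀ i : I, dual (i : C) ⊗ (X ⊗ (i : C)) ⟶ W') :
    freeLift f ≫ freeDesc g = ∑ i, f i ≫ g i := by
  rw [← Category.id_comp (freeDesc g), ← free_total, Preadditive.sum_comp, Preadditive.comp_sum]
  exact Finset.sum_congr rfl fun i _ => by
    rw [Category.assoc, freeι_freeDesc, reassoc_of% freeLift_freeπ f i]

variable [MonoidalPreadditive C]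

lemma hom_whiskerLeft_free_ext {X V Y : C} {f g : V ⟶ Y ⊗ freeObj I X}
    (h : ∀ j : I, f ≫ Y ◁ freeπ X j = g ≫ Y ◁ freeπ X j) : f = g := by
  have htotal : 𝟙 (Y ⊗ freeObj I X) = ∑ j : I, Y ◁ freeπ X j ≫ Y ◁ freeι X j := by
    simp only [← whiskerLeft_comp, ← whiskerLeft_sum, free_total, whiskerLeft_id]
  rw [← Category.comp_id f, ← Category.comp_id g, htotal, Preadditive.comp_sum,
    Preadditive.comp_sum]
  exact Finset.sum_congr rfl fun j _ => by rw [reassoc_of% h j]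

variable (k : Type w) [CommRing k] [Linear k C] [MonoidalLinear k C] [IsFusionCategory k C]
  (hI : IsRepresentativeSet k I)

lemma freeι_freeBraid_freeπ (X Y : C) (i j : I) :
    freeι X i ▷ Y ≫ freeBraid k hI X Y ≫ Y ◁ freeπ X j =
      ∑ a, bendMap X ((partition k hI ((i : C) ⊗ Y)).incl j a)
        ((partition k hI ((i : C) ⊗ Y)).proj j a) := by
  rw [reassoc_of% (freeι_freeBraid k hI X Y i), Preadditive.sum_comp]
  refine Finset.sum_congr rfl fun a _ => ?_
  rw [Category.assoc, ← whiskerLeft_comp]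
  generalize partition k hI ((i : C) ⊗ Y) = P at a ⊢
  by_cases h : P.label a = j
  · subst h
    rw [freeι_freeπ_self, whiskerLeft_id, Category.comp_id, P.incl_label, P.proj_label]
  · rw [freeι_freeπ_ne X h, MonoidalPreadditive.whiskerLeft_zero, comp_zero, P.proj_of_ne h,
      bendMap_zero_right]

variable {k}

lemma freeι_unit_freeBraid (X : C) (i : I) :
    freeι X ⟨𝟙_ C, hI.unit_mem⟩ ▷ (i : C) ≫ freeBraid k hI X i =
      bendMap X (λ_ (i : C)).inv (λ_ (i : C)).hom ≫ (i : C) ◁ freeι X i := by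
  have h := sum_bendMap_change k hI X (𝟙 (𝟙_ C ⊗ (i : C))) _ (fun _ : Unit => i) _ _
    (partition k hI (𝟙_ C ⊗ (i : C))).total (fun _ => (λ_ (i : C)).hom)
    (fun _ => (λ_ (i : C)).inv) (by simp)
  simp only [Category.id_comp, Category.comp_id, Fintype.sum_unique] at h
  rw [freeι_freeBraid, h]

/-- The unit `X ⟶ Z(X)` of the free half braiding adjunction, with values in the summand indexed by
`𝟙_ C`. -/
noncomputable def freeUnit (hI : IsRepresentativeSet k I) (X : C) : X ⟶ freeObj I X :=
  (λ_ X).inv ≫ lcoev (𝟙_ C) ▷ X ≫ 𝟙 _ ⊗≫ freeι X ⟨𝟙_ C, hI.unit_mem⟩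

lemma freeUnit_freeBraid (X : C) (i : I) :
    freeUnit hI X ▷ (i : C) ≫ freeBraid k hI X i =
      (λ_ _).inv ≫ lcoev (i : C) ▷ (X ⊗ i) ≫ (α_ _ _ _).hom ≫ (i : C) ◁ freeι X i := by
  calc
    _ = (λ_ _).inv ≫ lcoev (𝟙_ C) ▷ (X ⊗ i) ≫ 𝟙 _ ⊗≫
          (freeι X ⟨𝟙_ C, hI.unit_mem⟩ ▷ (i : C) ≫ freeBraid k hI X i) := by
      rw [freeUnit]; monoidal
    _ = ((λ_ _).inv ≫ lcoev (𝟙_ C) ▷ (X ⊗ i) ≫ 𝟙 _ ⊗≫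
          bendMap X (λ_ (i : C)).inv (λ_ (i : C)).hom) ≫ (i : C) ◁ freeι X i := by
      rw [freeι_unit_freeBraid]; monoidal
    _ = _ := by rw [lcoev_unit_bendMap]; simp only [Category.assoc]

lemma freeDesc_counitComp_halfBraiding {A : C} (σ : HalfBraiding A) (Y : C) :
    freeDesc (fun i : I => counitComp σ i) ▷ Y ≫ (σ.β Y).hom =
      freeBraid k hI A Y ≫ Y ◁ freeDesc (fun i : I => counitComp σ i) := by
  refine free_hom_ext fun i => ?_
  rw [← comp_whiskerRight_assoc, freeι_freeDesc, counitComp_halfBraiding,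
    reassoc_of% (freeι_freeBraid k hI A Y i), Preadditive.sum_comp]
  simp only [Category.assoc, ← whiskerLeft_comp, freeι_freeDesc, bendMap_counitComp]
  simp only [← Preadditive.comp_sum, ← Preadditive.sum_comp, ← whiskerLeft_sum,
    ← sum_whiskerRight, ScalarPartition.total, id_whiskerRight, Category.comp_id]

lemma freeDesc_map_freeBraid {X X' : C} (t : X ⟶ X') (Y : C) :
    freeDesc (fun i : I => dual (i : C) ◁ t ▷ (i : C) ≫ freeι X' i) ▷ Y ≫ freeBraid k hI X' Y =
      freeBraid k hI X Y ≫
        Y ◁ freeDesc (fun i : I => dual (i : C) ◁ t ▷ (i : C) ≫ freeι X' i) := by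
  refine free_hom_ext fun i => ?_
  rw [← comp_whiskerRight_assoc, freeι_freeDesc, comp_whiskerRight_assoc, freeι_freeBraid,
    reassoc_of% (freeι_freeBraid k hI X Y i), Preadditive.sum_comp, Preadditive.comp_sum]
  refine Finset.sum_congr rfl fun a _ => ?_
  rw [reassoc_of% (whiskerLeft_whiskerRight_bendMap t), Category.assoc, ← whiskerLeft_comp,
    ← whiskerLeft_comp, freeι_freeDesc]

lemma eq_freeDesc_comp_freeDesc_counitComp {X A : C} (σ : HalfBraiding A) {f : freeObj I X ⟶ A}
    (hf : ∀ Y, f ▷ Y ≫ (σ.β Y).hom = freeBraid k hI X Y ≫ Y ◁ f) :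
    f = freeDesc (fun i : I => dual (i : C) ◁ (freeUnit hI X ≫ f) ▷ (i : C) ≫ freeι A i) ≫
      freeDesc fun i : I => counitComp σ i := by
  refine biproduct.hom_ext' _ _ fun i => ?_
  change freeι X i ≫ f = freeι X i ≫ freeDesc _ ≫ freeDesc _
  rw [reassoc_of% (freeι_freeDesc (I := I) (X := X)), Category.assoc, freeι_freeDesc,
    whiskerLeft_whiskerRight_counitComp, Equiv.eq_symm_apply, comp_whiskerRight, Category.assoc,
    hf, reassoc_of% (freeUnit_freeBraid hI X i), ← whiskerLeft_comp]
  rfl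

end FreeComponents

section FreeAdjunction

variable {k : Type w} [CommRing k] {C : Type u} [Category.{v} C] [MonoidalCategory C]
  [PivotalCategory C] [Preadditive C] [Linear k C] [HasFiniteBiproducts C]
  [MonoidalPreadditive C] [MonoidalLinear k C] [IsFusionCategory k C] {I : Finset C}
  (hI : IsRepresentativeSet k I)

/-- The action of the free half braiding functor `F` on morphisms. -/
noncomputable def freeHalfBraidingMap {X X' : C} (t : X ⟶ X') :
    freeHalfBraiding k hI X ⟶ freeHalfBraiding k hI X' where
  f := freeDesc fun i : I => dual (i : C) ◁ t ▷ (i : C) ≫ freeι X' i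
  comm := freeDesc_map_freeBraid hI t

/-- The counit `F(A) ⟶ (A, σ)` of the free half braiding adjunction. -/
noncomputable def freeCounit (M : Center C) : freeHalfBraiding k hI M.1 ⟶ M where
  f := freeDesc fun i : I => counitComp M.2 i
  comm := freeDesc_counitComp_halfBraiding hI M.2

lemma hom_eq_map_comp_counit {X : C} {M : Center C} (e : freeHalfBraiding k hI X ⟶ M) :
    e = freeHalfBraidingMap hI (freeUnit hI X ≫ e.f) ≫ freeCounit hI M :=
  Center.ext _ _ (eq_freeDesc_comp_freeDesc_counitComp hI M.2 e.comm)

lemma exists_section_of_retract {X : C} {M : Center C} (r : Retract M (freeHalfBraiding k hI X)) :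
    ∃ s : M ⟶ freeHalfBraiding k hI M.1, s ≫ freeCounit hI M = 𝟙 M :=
  ⟨r.i ≫ freeHalfBraidingMap hI (freeUnit hI X ≫ r.r.f), by
    rw [Category.assoc, ← hom_eq_map_comp_counit, r.retract]⟩

end FreeAdjunction

section WeightedSection

variable {k : Type w} [CommRing k] {C : Type u} [Category.{v} C] [MonoidalCategory C]
  [PivotalCategory C] [Preadditive C] [Linear k C] [HasFiniteBiproducts C]
  [MonoidalPreadditive C] [MonoidalLinear k C] {I : Finset C}

/-- The morphism `A ⟶ Z(A)` with components `c_i • sectionComp σ i`. -/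
noncomputable def weightedSection {A : C} (σ : HalfBraiding A) (c : I → k) : A ⟶ freeObj I A :=
  freeLift fun i : I => c i • sectionComp σ i

variable [IsFusionCategory k C]

lemma weightedSection_freeDesc_counitComp {A : C} (σ : HalfBraiding A) (c : I → k) :
    weightedSection σ c ≫ freeDesc (fun i : I => counitComp σ i) =
      (∑ i : I, c i * leftDim k (i : C)) • 𝟙 A := by
  rw [weightedSection, freeLift_freeDesc, Finset.sum_smul]
  refine Finset.sum_congr rfl fun i _ => ?_
  rw [Linear.smul_comp, sectionComp_counitComp, ← leftDim_smul_id (k := k),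
    MonoidalLinear.whiskerLeft_smul, whiskerLeft_id, Linear.smul_comp, Category.id_comp,
    Linear.comp_smul, Iso.inv_hom_id, smul_smul]

variable (hI : IsRepresentativeSet k I)

lemma weightedSection_freeBraid_freeπ {A : C} (σ : HalfBraiding A) (c : I → k) (j : I) (Y : C) :
    weightedSection σ c ▷ Y ≫ freeBraid k hI A Y ≫ Y ◁ freeπ A j =
      ((σ.β Y).hom ≫ Y ◁ sectionComp σ j ≫ (α_ _ _ _).inv) ≫
        transfer hI c j Y ▷ (A ⊗ j) ≫ (α_ _ _ _).hom := by
  have hsum : weightedSection σ c = ∑ i : I, (c i • sectionComp σ i) ≫ freeι A i := by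
    rw [← Category.comp_id (weightedSection σ c), ← free_total, Preadditive.comp_sum]
    exact Finset.sum_congr rfl fun i _ => by
      rw [weightedSection, reassoc_of% freeLift_freeπ (fun i : I => c i • sectionComp σ i) i]
  simp only [hsum, sum_whiskerRight, Preadditive.sum_comp, comp_whiskerRight, Category.assoc,
    freeι_freeBraid_freeπ, MonoidalLinear.smul_whiskerRight, Linear.smul_comp,
    Preadditive.comp_sum, sectionComp_bendMap, transfer, Linear.comp_smul]

lemma weightedSection_freeBraid_iff {A : C} (σ : HalfBraiding A) (c : I → k) (Y : C) :
    weightedSection σ c ▷ Y ≫ freeBraid k hI A Y = (σ.β Y).hom ≫ Y ◁ weightedSection σ c ↔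
      ∀ j : I, Y ◁ sectionComp σ j ≫ (α_ _ _ _).inv ≫ transfer hI c j Y ▷ (A ⊗ j) =
        Y ◁ sectionComp σ j ≫ (α_ _ _ _).inv ≫ (c j • 𝟙 (Y ⊗ dual (j : C))) ▷ (A ⊗ j) := by
  have hcomp (j : I) : ((σ.β Y).hom ≫ Y ◁ weightedSection σ c) ≫ Y ◁ freeπ A j =
      ((σ.β Y).hom ≫ Y ◁ sectionComp σ j ≫ (α_ _ _ _).inv) ≫
        (c j • 𝟙 (Y ⊗ dual (j : C))) ▷ (A ⊗ j) ≫ (α_ _ _ _).hom := by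
    rw [Category.assoc, ← whiskerLeft_comp, weightedSection, freeLift_freeπ]
    simp
  have hpair : (weightedSection σ c ▷ Y ≫ freeBraid k hI A Y =
      (σ.β Y).hom ≫ Y ◁ weightedSection σ c) ↔ ∀ j : I,
        (weightedSection σ c ▷ Y ≫ freeBraid k hI A Y) ≫ Y ◁ freeπ A j =
          ((σ.β Y).hom ≫ Y ◁ weightedSection σ c) ≫ Y ◁ freeπ A j :=
    ⟨fun h j => by rw [h], hom_whiskerLeft_free_ext⟩
  rw [hpair]
  refine forall_congr' fun j => ?_
  rw [hcomp, Category.assoc, weightedSection_freeBraid_freeπ]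
  simp only [Category.assoc, cancel_epi]
  simp only [← Category.assoc, cancel_mono]

/-- A morphism to a free half braiding, whose weights, the right dimensions, are those for which
`transfer` is a multiple of the identity. -/
noncomputable def dimSection (M : Center C) : M ⟶ freeHalfBraiding k hI M.1 where
  f := weightedSection M.2 fun i : I => rightDim k (i : C)
  comm Y := (weightedSection_freeBraid_iff hI M.2 _ Y).2 fun j => by rw [transfer_rightDim]

lemma dimSection_freeCounit (M : Center C) :
    (dimSection hI M ≫ freeCounit hI M).f = categoryDim k I • 𝟙 M.1 := by
  refine (weightedSection_freeDesc_counitComp M.2 _).trans ?_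
  simp only [categoryDim, ← Finset.sum_coe_sort I, mul_comm]

lemma nonempty_retract_of_isUnit (h : IsUnit (categoryDim k I : k)) (M : Center C) :
    Nonempty (Retract M (freeHalfBraiding k hI M.1)) := by
  obtain ⟨b, hb⟩ := h.exists_right_inv
  refine ⟨{ i := dimSection hI M, r := ⟨b • (freeCounit hI M).f, fun Y => ?_⟩, retract := ?_ }⟩
  · simp only [MonoidalLinear.smul_whiskerRight, MonoidalLinear.whiskerLeft_smul,
      Linear.smul_comp, Linear.comp_smul, Center.Hom.comm]
  · refine Center.ext _ _ ?_
    change (dimSection hI M).f ≫ (b • (freeCounit hI M).f) = 𝟙 M.1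
    rw [Linear.comp_smul, ← Center.comp_f, dimSection_freeCounit, smul_smul, mul_comm, hb,
      one_smul]

end WeightedSection

section Converse

variable {k : Type w} [CommRing k] {C : Type u} [Category.{v} C] [MonoidalCategory C]
  [PivotalCategory C] [Preadditive C] [Linear k C] [MonoidalPreadditive C] [MonoidalLinear k C]

lemma exists_eq_smul_sectionComp_unit {i : C} (hi : IsScalar k i)
    (f : 𝟙_ C ⟶ dual i ⊗ (𝟙_ C ⊗ i)) : ∃ c : k, f = c • sectionComp (unitHalfBraiding C) i := by
  obtain ⟨g, hg⟩ := (tensorLeftHomEquiv (𝟙_ C) (dual i) i i).surjective (f ≫ dual i ◁ (λ_ i).hom)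
  obtain ⟨c, hc⟩ := hi.2 ((ρ_ i).inv ≫ g)
  have hgc : g = c • (ρ_ i).hom := by
    rw [← Iso.hom_inv_id_assoc (ρ_ i) g, ← hc, Linear.comp_smul, Category.comp_id]
  have hf : f ≫ dual i ◁ (λ_ i).hom = c • rcoev i := by
    calc
      _ = (λ_ _).inv ≫ rcoev i ▷ 𝟙_ C ≫ (α_ _ _ _).hom ≫ dual i ◁ g := hg.symm
      _ = c • ((λ_ _).inv ≫ rcoev i ▷ 𝟙_ C ≫ (α_ _ _ _).hom ≫ dual i ◁ (ρ_ i).hom) := by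
        simp only [hgc, MonoidalLinear.whiskerLeft_smul, Linear.comp_smul]
      _ = c • rcoev i := by congr 1; monoidal
  refine ⟨c, ?_⟩
  rw [sectionComp_unit, ← Linear.smul_comp, ← hf, Category.assoc, whiskerLeft_hom_inv,
    Category.comp_id]

lemma smul_lcoev_injective {i : C} (hi : IsScalar k i) :
    Function.Injective fun a : k => a • lcoev i := by
  have hid (a : k) : (λ_ i).inv ≫ ((a • lcoev i) ▷ i ⊗≫ i ◁ lev i) ≫ (ρ_ i).hom = a • 𝟙 i := by
    calc
      _ = a • ((λ_ i).inv ≫ (lcoev i ▷ i ⊗≫ i ◁ lev i) ≫ (ρ_ i).hom) := by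
        simp only [monoidalComp, MonoidalLinear.smul_whiskerRight, Linear.smul_comp,
          Linear.comp_smul]
      _ = a • 𝟙 i := by rw [lcoev_lev]; congr 1; monoidal
  intro a b hab
  have h := congrArg (fun f => (λ_ i).inv ≫ (f ▷ i ⊗≫ i ◁ lev i) ≫ (ρ_ i).hom) hab
  exact hi.1 (by simpa only [hid] using h)

variable [HasFiniteBiproducts C] {I : Finset C}

lemma exists_eq_weightedSection_unit (hI : IsRepresentativeSet k I) (s : 𝟙_ C ⟶ freeObj I (𝟙_ C)) :
    ∃ c : I → k, s = weightedSection (unitHalfBraiding C) c := by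
  choose c hc using fun i : I =>
    exists_eq_smul_sectionComp_unit (hI.scalar _ i.2) (s ≫ freeπ (𝟙_ C) i)
  exact ⟨c, biproduct.hom_ext _ _ fun i => (hc i).trans
    (freeLift_freeπ (fun i : I => c i • sectionComp (unitHalfBraiding C) (i : C)) i).symm⟩

variable [IsFusionCategory k C] (hI : IsRepresentativeSet k I)

lemma transfer_eq_of_weightedSection_unit_comm {c : I → k} {Y : C}
    (hc : weightedSection (unitHalfBraiding C) c ▷ Y ≫ freeBraid k hI (𝟙_ C) Y =
      ((unitHalfBraiding C).β Y).hom ≫ Y ◁ weightedSection (unitHalfBraiding C) c) (j : I) :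
    transfer hI c j Y = c j • 𝟙 _ :=
  whiskerLeft_sectionComp_unit_injective
    ((weightedSection_freeBraid_iff hI (unitHalfBraiding C) c Y).1 hc j)

lemma rightDim_mul_weight_eq {c : I → k} (hc : ∀ (j : I) (Y : C), transfer hI c j Y = c j • 𝟙 _)
    (i : I) : rightDim k (i : C) * c ⟨𝟙_ C, hI.unit_mem⟩ = rightDim k (𝟙_ C) * c i :=
  smul_lcoev_injective (hI.scalar _ i.2)
    (rightDim_mul_smul_of_transfer_eq (j := ⟨𝟙_ C, hI.unit_mem⟩) hI (hc _ _) (lcoev (i : C)))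

lemma categoryDim_mul_weight_eq {c : I → k}
    (hc : ∀ (j : I) (Y : C), transfer hI c j Y = c j • 𝟙 _)
    (hsum : ∑ i : I, c i * leftDim k (i : C) = 1) :
    categoryDim k I * c ⟨𝟙_ C, hI.unit_mem⟩ = rightDim k (𝟙_ C) := by
  calc
    _ = ∑ i : I, leftDim k (i : C) * (rightDim k (i : C) * c ⟨𝟙_ C, hI.unit_mem⟩) := by
      simp only [categoryDim, ← Finset.sum_coe_sort I, Finset.sum_mul, mul_assoc]
    _ = rightDim k (𝟙_ C) * ∑ i : I, c i * leftDim k (i : C) := by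
      simp only [rightDim_mul_weight_eq hI hc, Finset.mul_sum, mul_left_comm, mul_comm (c _)]
    _ = rightDim k (𝟙_ C) := by rw [hsum, mul_one]

lemma isUnit_categoryDim_of_section (s : 𝟙_ (Center C) ⟶ freeHalfBraiding k hI (𝟙_ C))
    (hs : s ≫ freeCounit hI (𝟙_ (Center C)) = 𝟙 _) : IsUnit (categoryDim k I : k) := by
  obtain ⟨c, hc⟩ := exists_eq_weightedSection_unit hI s.f
  have hcomm (Y : C) : weightedSection (unitHalfBraiding C) c ▷ Y ≫ freeBraid k hI (𝟙_ C) Y =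
      ((unitHalfBraiding C).β Y).hom ≫ Y ◁ weightedSection (unitHalfBraiding C) c :=
    hc ▸ s.comm Y
  have htransfer (j : I) (Y : C) : transfer hI c j Y = c j • 𝟙 _ :=
    transfer_eq_of_weightedSection_unit_comm hI (hcomm Y) j
  have hsum : ∑ i : I, c i * leftDim k (i : C) = 1 := by
    apply (IsFusionCategory.scalar_unit (k := k) (C := C)).1
    have hsplit : s.f ≫ freeDesc (fun i : I => counitComp (unitHalfBraiding C) (i : C)) =
        𝟙 (𝟙_ C) := congrArg Center.Hom.f hs
    rw [hc] at hsplit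
    simpa only [one_smul] using
      (weightedSection_freeDesc_counitComp (unitHalfBraiding C) c).symm.trans hsplit
  refine IsUnit.of_mul_eq_one (c ⟨𝟙_ C, hI.unit_mem⟩ * leftDim k (𝟙_ C)) ?_
  rw [← mul_assoc, categoryDim_mul_weight_eq hI htransfer hsum, mul_comm,
    leftDim_unit_mul_rightDim_unit]

end Converse

end FusionCenter

theorem mainTheorem3 {k : Type w} [CommRing k] {C : Type u} [Category.{v} C] [Preadditive C]
    [Linear k C] [MonoidalCategory C] [HasFiniteBiproducts C] [MonoidalPreadditive C]
    [MonoidalLinear k C] [FusionCenter.IsFusionCategory k C] [FusionCenter.PivotalCategory C]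
    (I : Finset C) (hI : FusionCenter.IsRepresentativeSet k I) :
    IsUnit (FusionCenter.categoryDim k I) ↔
      ∀ M : Center C, ∃ X : C, Nonempty (Retract M (FusionCenter.freeHalfBraiding k hI X)) := by
  refine ⟨fun h M => ⟨M.1, FusionCenter.nonempty_retract_of_isUnit hI h M⟩, fun h => ?_⟩
  obtain ⟨X, ⟨r⟩⟩ := h (𝟙_ (Center C))
  obtain ⟨s, hs⟩ := FusionCenter.exists_section_of_retract hI r
  exact FusionCenter.isUnit_categoryDim_of_section hI s hs
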